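/- Let $\mathcal H$ be a complex separable Hilbert space with an orthonormal basis $\{\xi_j\}_{0\le j<\omega}$, where $\omega\in\mathbb N\cup\{\aleph_0\}$. Consider the Banach–Lie group $G=\mathrm{GL}(\mathcal H)$ of all invertible bounded linear operators on $\mathcal H$ (as a real Banach–Lie group) and its subgroups $$K=\{k\in G\mid k^*k=\mathbf 1\},\quad A=\{a\in G\mid a\xi_j\in\mathbb R_{+}^{*}\,\xi_j\ \text{for all } j\},\quad N=\{n\in G\mid n\xi_j\in\xi_j+\mathrm{span}_{\mathbb C}\{\xi_l\mid l<j\}\ \text{for all } j\},$$ where $\mathbb R_+^*=(0,\infty)$. Consider also $\mathfrak g=\mathcal B(\mathcal H)$, as a real Banach–Lie algebra with the commutator bracket, and its closed real Lie subalgebras $$\mathfrak k=\{X\in\mathfrak g\mid X^*=-X\},\quad \mathfrak a=\{Y\in\mathfrak g\mid Y\xi_j\in\mathbb R\,\xi_j\ \text{for all } j\},\quad \mathfrak n=\{Z\in\mathfrak g\mid Z\xi_j\in\mathrm{span}_{\mathbb C}\{\xi_l\mid l<j\}\ \text{for all } j\}.$$ Then the following assertions hold. 1. $K$, $A$ and $N$,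 with the norm topology, are Banach–Lie groups with Lie algebras $\mathfrak k$, $\mathfrak a$ and $\mathfrak n$, respectively; that is, they carry smooth structures modelled on $\mathfrak k$, $\mathfrak a$, $\mathfrak n$ for which the group operations and the inclusions into $G$ are smooth and the derivative at $\mathbf 1$ of the inclusion is an isomorphism of topological Lie algebras from the tangent space at $\mathbf 1$ onto $\mathfrak k$, $\mathfrak a$, $\mathfrak n$. For these structures, the multiplication map $\mathbf m\colon K\times A\times N\to G$, $(k,a,n)\mapsto kan$, is smooth and bijective. 2. The map $\mathbf m$ is a diffeomorphism if and only if $\mathfrak g=\mathfrak k\dotplus\mathfrak a\dotplus\mathfrak n$ (internal direct sum of real vector spaces), and this equality holds if and only if $\mathcal H$ is finite-dimensional. -/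

import Mathlib

open scoped Manifold ContDiff

/-- The index set `{j : 0 ≤ j < κ}` of the orthonormal basis, for `κ ∈ ℕ ∪ {ℵ₀}`. -/
abbrev BasisIndex (κ : ℕ∞) : Type := {j : ℕ // (j : ℕ∞) < κ}

/-- `GL(H)`: the invertible bounded operators on `H`.  With Mathlib's charts on the units of a
Banach algebra this is a Lie group modelled on the real Banach space `H →L[ℂ] H`. -/
abbrev GLH (H : Type*) [NormedAddCommGroup H] [InnerProductSpace ℂ H] [CompleteSpace H] : Type _ :=
  (H →L[ℂ] H)ˣ

-- the Lie bracket of operators is the commutator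
attribute [local instance] LieRing.ofAssociativeRing

section Iwasawa

variable {H : Type*} [NormedAddCommGroup H] [InnerProductSpace ℂ H]

variable {κ : ℕ∞}

/-- `span {ξ_l : l < j}`. -/
def lowerSpan (ξ : HilbertBasis (BasisIndex κ) ℂ H) (j : BasisIndex κ) : Submodule ℂ H :=
  Submodule.span ℂ (ξ '' {l | l < j})

theorem lowerSpan_mono (ξ : HilbertBasis (BasisIndex κ) ℂ H) {i j : BasisIndex κ} (h : i ≤ j) :
    lowerSpan ξ i ≤ lowerSpan ξ j :=
  Submodule.span_mono (Set.image_mono fun _ hl => lt_of_lt_of_le hl h)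

theorem basis_mem_lowerSpan (ξ : HilbertBasis (BasisIndex κ) ℂ H) {i j : BasisIndex κ}
    (h : i < j) : ξ i ∈ lowerSpan ξ j :=
  Submodule.subset_span ⟨i, h, rfl⟩

/-- A linear map sending each `ξ_j` into `ξ_j + span {ξ_l : l < j}` preserves these spans. -/
theorem unipotent_mem_lowerSpan (ξ : HilbertBasis (BasisIndex κ) ℂ H) {T : H →L[ℂ] H}
    (hT : ∀ j, T (ξ j) - ξ j ∈ lowerSpan ξ j) {j : BasisIndex κ} {x : H}
    (hx : x ∈ lowerSpan ξ j) : T x ∈ lowerSpan ξ j := by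
  have : lowerSpan ξ j ≤ (lowerSpan ξ j).comap (T : H →ₗ[ℂ] H) := by
    refine Submodule.span_le.2 ?_
    rintro _ ⟨l, hl, rfl⟩
    have h := add_mem (lowerSpan_mono ξ (le_of_lt hl) (hT l)) (basis_mem_lowerSpan ξ hl)
    simpa using h
  exact this hx

/-- A map sending each `ξ_j` into `span {ξ_l : l < j}` preserves these spans. -/
theorem strict_mem_lowerSpan (ξ : HilbertBasis (BasisIndex κ) ℂ H) {T : H →L[ℂ] H}
    (hT : ∀ j, T (ξ j) ∈ lowerSpan ξ j) {j : BasisIndex κ} {x : H}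
    (hx : x ∈ lowerSpan ξ j) : T x ∈ lowerSpan ξ j := by
  have : lowerSpan ξ j ≤ (lowerSpan ξ j).comap (T : H →ₗ[ℂ] H) := by
    refine Submodule.span_le.2 ?_
    rintro _ ⟨l, hl, rfl⟩
    exact lowerSpan_mono ξ (le_of_lt hl) (hT l)
  exact this hx

variable [CompleteSpace H]

/-- `K = {k ∈ GL(H) : k* k = 1}`. -/
def groupK (H : Type*) [NormedAddCommGroup H] [InnerProductSpace ℂ H] [CompleteSpace H] :
    Subgroup (GLH H) where
  carrier := {k | star (k : H →L[ℂ] H) * k = 1}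
  mul_mem' := by
    intro a b ha hb
    simp only [Set.mem_ofPred_eq, Units.val_mul, star_mul] at *
    rw [mul_assoc, ← mul_assoc (star (a : H →L[ℂ] H)), ha, one_mul, hb]
  one_mem' := by simp
  inv_mem' := by
    intro a ha
    simp only [Set.mem_ofPred_eq] at *
    have h : star (a : H →L[ℂ] H) = ((a⁻¹ : GLH H) : H →L[ℂ] H) :=
      Units.eq_inv_of_mul_eq_one_right ha
    rw [← h, star_star, h, Units.mul_inv]

/-- `A`: each `a ξ_j` is a strictly positive real multiple of `ξ_j`. -/
def groupA (ξ : HilbertBasis (BasisIndex κ) ℂ H) : Subgroup (GLH H) where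
  carrier := {a | ∀ j, ∃ r : ℝ, 0 < r ∧ (a : H →L[ℂ] H) (ξ j) = (r : ℂ) • ξ j}
  mul_mem' := by
    intro a b ha hb j
    obtain ⟨r, hr, har⟩ := ha j
    obtain ⟨s, hs, hbs⟩ := hb j
    refine ⟨s * r, mul_pos hs hr, ?_⟩
    rw [Units.val_mul, mul_apply_eq_comp, hbs, map_smul, har, smul_smul, Complex.ofReal_mul]
  one_mem' := fun j => ⟨1, one_pos, by simp⟩
  inv_mem' := by
    intro a ha j
    obtain ⟨r, hr, har⟩ := ha j
    refine ⟨r⁻¹, inv_pos.2 hr, ?_⟩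
    have h1 : ((a⁻¹ : GLH H) : H →L[ℂ] H) ((a : H →L[ℂ] H) (ξ j)) = ξ j := by
      rw [← mul_apply_eq_comp, Units.inv_mul, one_apply_eq_self]
    rw [har, map_smul] at h1
    have hr' : (r : ℂ) ≠ 0 := by exact_mod_cast hr.ne'
    rw [← h1, smul_smul]
    simp [hr', h1]

/-- `N`: each `n ξ_j` lies in `ξ_j + span {ξ_l : l < j}`. -/
def groupN (ξ : HilbertBasis (BasisIndex κ) ℂ H) : Subgroup (GLH H) where
  carrier := {n | ∀ j, (n : H →L[ℂ] H) (ξ j) - ξ j ∈ lowerSpan ξ j}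
  mul_mem' := by
    intro a b ha hb j
    have h := add_mem (unipotent_mem_lowerSpan ξ ha (hb j)) (ha j)
    simpa using h
  one_mem' := fun j => by simp
  inv_mem' := by
    intro a ha j
    set T : H →L[ℂ] H := (a : H →L[ℂ] H)
    set S : H →L[ℂ] H := ((a⁻¹ : GLH H) : H →L[ℂ] H)
    have hST : ∀ x, S (T x) = x := fun x => by
      rw [← mul_apply_eq_comp, Units.inv_mul, one_apply_eq_self]
    have hfin : FiniteDimensional ℂ (lowerSpan ξ j) := by
      refine FiniteDimensional.span_of_finite ℂ (Set.Finite.image _ ?_)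
      exact Set.Finite.of_injOn (f := Subtype.val) (t := Set.Iio (j : ℕ))
        (fun l hl => hl) Subtype.val_injective.injOn (Set.finite_Iio _)
    let R : lowerSpan ξ j →ₗ[ℂ] lowerSpan ξ j :=
      (T : H →ₗ[ℂ] H).restrict fun x hx => unipotent_mem_lowerSpan ξ ha hx
    have hinj : Function.Injective R := by
      intro x y hxy
      have h : T x = T y := congrArg Subtype.val hxy
      exact Subtype.ext (by rw [← hST x, h, hST])
    obtain ⟨y, hy⟩ := LinearMap.surjective_of_injective hinj ⟨_, ha j⟩
    have hy' : T y = T (ξ j) - ξ j := congrArg Subtype.val hy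
    have h2 : (y : H) = ξ j - S (ξ j) := by rw [← hST y, hy', map_sub, hST]
    have h3 := neg_mem y.2
    rw [h2, neg_sub] at h3
    exact h3

/-- `𝔨 = {X : X* = -X}`, as a real Lie subalgebra of `B(H)`. -/
def algK (H : Type*) [NormedAddCommGroup H] [InnerProductSpace ℂ H] [CompleteSpace H] :
    LieSubalgebra ℝ (H →L[ℂ] H) where
  carrier := {X | star X = -X}
  add_mem' := by
    intro X Y hX hY
    simp only [Set.mem_ofPred_eq, star_add] at *
    rw [hX, hY]; abel
  zero_mem' := by simp
  smul_mem' := by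
    intro r X hX
    simp only [Set.mem_ofPred_eq, star_smul, star_trivial] at *
    rw [hX, smul_neg]
  lie_mem' := by
    intro X Y hX hY
    change star X = -X at hX
    change star Y = -Y at hY
    change star (X * Y - Y * X) = -(X * Y - Y * X)
    rw [star_sub, star_mul, star_mul, hX, hY]
    noncomm_ring

/-- `𝔞`: each `Y ξ_j` is a real multiple of `ξ_j`. -/
def algA (ξ : HilbertBasis (BasisIndex κ) ℂ H) : LieSubalgebra ℝ (H →L[ℂ] H) where
  carrier := {Y | ∀ j, ∃ r : ℝ, Y (ξ j) = (r : ℂ) • ξ j}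
  add_mem' := by
    intro X Y hX hY j
    obtain ⟨r, hr⟩ := hX j
    obtain ⟨s, hs⟩ := hY j
    exact ⟨r + s, by simp [hr, hs, add_smul]⟩
  zero_mem' := fun j => ⟨0, by simp⟩
  smul_mem' := by
    intro c X hX j
    obtain ⟨r, hr⟩ := hX j
    refine ⟨c * r, ?_⟩
    change c • X (ξ j) = _
    rw [hr, ← Complex.coe_smul c, smul_smul, Complex.ofReal_mul]
  lie_mem' := by
    intro X Y hX hY j
    obtain ⟨r, hr⟩ := hX j
    obtain ⟨s, hs⟩ := hY j
    refine ⟨0, ?_⟩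
    simp [Ring.lie_def, hr, hs, smul_smul, mul_comm]

/-- `𝔫`: each `Z ξ_j` lies in `span {ξ_l : l < j}`. -/
def algN (ξ : HilbertBasis (BasisIndex κ) ℂ H) : LieSubalgebra ℝ (H →L[ℂ] H) where
  carrier := {Z | ∀ j, Z (ξ j) ∈ lowerSpan ξ j}
  add_mem' := fun {X Y} hX hY j => add_mem (hX j) (hY j)
  zero_mem' := fun j => zero_mem _
  smul_mem' := by
    intro c X hX j
    change c • X (ξ j) ∈ _
    rw [← Complex.coe_smul c]
    exact Submodule.smul_mem _ _ (hX j)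
  lie_mem' := fun {X Y} hX hY j =>
    sub_mem (strict_mem_lowerSpan ξ hX (hY j)) (strict_mem_lowerSpan ξ hY (hX j))

/-- The smooth structure given by the charts on the subgroup `S` of `GL(H)` (charts for the norm
topology, with values in the real normed space `𝔰`) makes `S` a Lie group with Lie algebra `𝔰`:
the group operations and the inclusion `S → GL(H)` are smooth, and the derivative of the
inclusion at `1` is an isomorphism of topological Lie algebras from `T₁ S`, with the bracket of
left-invariant vector fields, onto `𝔰`, with the commutator bracket of operators. -/
structure IsLieGroupWithLieAlgebra (S : Subgroup (GLH H)) (𝔰 : LieSubalgebra ℝ (H →L[ℂ] H))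
    [ChartedSpace 𝔰.toSubmodule S] : Prop where
  lieGroup : LieGroup 𝓘(ℝ, 𝔰.toSubmodule) ∞ S
  contMDiff_incl :
    ContMDiff 𝓘(ℝ, 𝔰.toSubmodule) 𝓘(ℝ, H →L[ℂ] H) ∞ (fun g : S => (g : GLH H))
  lieAlgebra : ∃ e : GroupLieAlgebra 𝓘(ℝ, 𝔰.toSubmodule) S ≃L[ℝ] 𝔰.toSubmodule,
    (∀ X : GroupLieAlgebra 𝓘(ℝ, 𝔰.toSubmodule) S,
      (mfderiv 𝓘(ℝ, 𝔰.toSubmodule) 𝓘(ℝ, H →L[ℂ] H) (fun g : S => (g : GLH H)) 1 X : H →L[ℂ] H)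
        = (e X : H →L[ℂ] H)) ∧
    ∀ X Y : GroupLieAlgebra 𝓘(ℝ, 𝔰.toSubmodule) S,
      (e ⁅X, Y⁆ : H →L[ℂ] H) = (e X : H →L[ℂ] H) * (e Y : H →L[ℂ] H) - (e Y : H →L[ℂ] H) * (e X : H →L[ℂ] H)

/-- The multiplication map `K × A × N → GL(H)`, `(k, a, n) ↦ k a n`. -/
def iwasawaMul (ξ : HilbertBasis (BasisIndex κ) ℂ H)
    (p : groupK H × groupA ξ × groupN ξ) : GLH H :=
  (p.1 : GLH H) * (p.2.1 : GLH H) * (p.2.2 : GLH H)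

/-- `𝔨 ∔ 𝔞 ∔ 𝔫 = B(H)`: the operator space is the internal direct sum of the three subspaces. -/
def IsIwasawaDirectSum (ξ : HilbertBasis (BasisIndex κ) ℂ H) : Prop :=
  DirectSum.IsInternal ![(algK H).toSubmodule, (algA ξ).toSubmodule, (algN ξ).toSubmodule]

end Iwasawa

/-! Bijectivity is Gram–Schmidt. Orthonormalising the vectors `g ξ_j` gives an orthonormal basis
`e_j`, and the unitary `k : ξ_j ↦ e_j` makes `b = k⁻¹ g` upper triangular with positive diagonal.
The diagonal entries of `b` and of `b⁻¹` are bounded by the operator norms, so the diagonal part `a`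
of `b` is bounded and invertible, and `a⁻¹ b` lies in `N`. Uniqueness holds because a unitary upper
triangular operator with positive diagonal is `1`. All this survives in infinite dimension because
the spaces `lowerSpan ξ j` are finite-dimensional, so an invertible operator preserving them has an
inverse preserving them.

For the Lie group structures, each subgroup is flattened near `1` by a chart of `GL(H)`: `u ↦ u - 1`
for `A` and `N`, the Cayley transform for `K`. Left translates of this chart form an atlas. No
complement of the Lie algebra in `B(H)` is needed, since smoothness of a map into a closed subspace
can be tested in the ambient space.

In left trivialisations the derivative of multiplication at `(k, a, n)` is `(X, Y, Z) ↦ k (X + Y + u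
Z u⁻¹) u` with `u = a n`. Conjugation by `u` preserves `𝔫`, and `𝔨`, `𝔞`, `𝔫` are always
independent, so this map is injective, and it is onto as soon as the three spaces span. The inverse
function theorem then yields a diffeomorphism; conversely, the derivative at `1` of a diffeomorphism
is onto. Only the derivative of each inclusion at `1` and left translation enter, so this works for
every admissible smooth structure.

If `T = X + Y + Z`, then above the diagonal `Z` must have entries `t i j + conj (t j i)`. In finite
dimension this formula defines the decomposition. In infinite dimension take for `T` the bounded
self-adjoint Hilbert matrix with entries proportional to `1 / (i - j)`: then `Z` is twice its
strictly upper triangular part, which is unbounded because the harmonic series diverges. -/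

section

open Filter Topology VectorField

/-! ### Smoothness of maps into closed subspaces -/

/-- A function is differentiable as soon as its composition with a linear isometry from a complete
space is. -/
theorem HasFDerivAt.exists_of_linearIsometry_comp {E P F : Type*}
    [NormedAddCommGroup E] [NormedSpace ℝ E] [NormedAddCommGroup P] [NormedSpace ℝ P]
    [NormedAddCommGroup F] [NormedSpace ℝ F] [CompleteSpace P] (ι : P →ₗᵢ[ℝ] F) {g : E → P}
    {L : E →L[ℝ] F} {y : E} (h : HasFDerivAt (fun z => ι (g z)) L y) :
    ∃ L' : E →L[ℝ] P, ι.toContinuousLinearMap.comp L' = L ∧ HasFDerivAt g L' y := by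
  have hclosed : IsClosed (LinearMap.range ι.toLinearMap : Set F) := by
    rw [LinearMap.coe_range]
    exact ι.isometry.isClosedEmbedding.isClosed_range
  -- A directional derivative is a limit of difference quotients, all of which lie in the range of
  -- `ι`; this range is closed because `P` is complete.
  have hmem : ∀ v, L v ∈ LinearMap.range ι.toLinearMap := by
    intro v
    have h1 : HasDerivAt (fun t : ℝ => ι (g (y + t • v))) (L v) 0 := h.hasLineDerivAt v
    have h2 := range_deriv_subset_closure_span_image
      (fun t : ℝ => ι (g (y + t • v))) (t := Set.univ) dense_univ ⟨0, rfl⟩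
    rw [h1.deriv] at h2
    have h3 : (Submodule.span ℝ ((fun t : ℝ => ι (g (y + t • v))) '' Set.univ) : Set F) ⊆
        LinearMap.range ι.toLinearMap := by
      refine Submodule.span_le.2 ?_
      rintro _ ⟨t, -, rfl⟩
      exact ⟨_, rfl⟩
    exact closure_minimal h3 hclosed h2
  choose q hq using hmem
  have hq' : ∀ v, ι (q v) = L v := hq
  let L₀ : E →ₗ[ℝ] P :=
    { toFun := q
      map_add' := fun a b => ι.injective (by simp [hq'])
      map_smul' := fun c a => ι.injective (by simp [hq']) }
  let L' : E →L[ℝ] P := L₀.mkContinuous ‖L‖ fun v => by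
    have : ‖L₀ v‖ = ‖ι (q v)‖ := (ι.norm_map _).symm
    rw [this, hq']
    exact L.le_opNorm v
  have hL' : ∀ v, ι (L' v) = L v := hq'
  refine ⟨L', by ext v; exact hL' v, ?_⟩
  rw [hasFDerivAt_iff_isLittleO] at h ⊢
  refine (Asymptotics.isLittleO_norm_left.1 ?_)
  refine (Asymptotics.isLittleO_norm_left.2 h).congr_left fun z => ?_
  rw [← hL', ← map_sub, ← map_sub, ι.norm_map]

/-- Postcomposition with a linear isometry is a linear isometry. -/
def LinearIsometry.postcompL {P F : Type*} (E : Type*)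
    [NormedAddCommGroup E] [NormedSpace ℝ E] [NormedAddCommGroup P] [NormedSpace ℝ P]
    [NormedAddCommGroup F] [NormedSpace ℝ F] (ι : P →ₗᵢ[ℝ] F) : (E →L[ℝ] P) →ₗᵢ[ℝ] (E →L[ℝ] F) where
  toFun L := ι.toContinuousLinearMap.comp L
  map_add' a b := by ext; simp
  map_smul' a b := by ext; simp
  norm_map' L := ι.norm_toContinuousLinearMap_comp

/-- Induction on `n`: the derivative of `g`, postcomposed with `ι`, is the derivative of `ι ∘ g`,
and postcomposition is again a linear isometry. The target therefore changes to `E →L[ℝ] P` at each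
step, which is why `P` and `F` are quantified inside the induction and all spaces share one
universe. -/
theorem ContDiffAt.of_linearIsometry_comp_nat.{u} {E : Type u} [NormedAddCommGroup E]
    [NormedSpace ℝ E]
    (n : ℕ) : ∀ {P F : Type u} [NormedAddCommGroup P] [NormedSpace ℝ P]
    [NormedAddCommGroup F] [NormedSpace ℝ F] [CompleteSpace P] (ι : P →ₗᵢ[ℝ] F) {g : E → P} {x : E},
    ContDiffAt ℝ n (fun z => ι (g z)) x → ContDiffAt ℝ n g x := by
  induction n with
  | zero =>
    intro P F _ _ _ _ _ ι g x h
    rw [Nat.cast_zero, contDiffAt_zero] at h ⊢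
    obtain ⟨u, hu, hc⟩ := h
    exact ⟨u, hu, ι.isometry.isEmbedding.continuousOn_iff.2 hc⟩
  | succ n ih =>
    intro P F _ _ _ _ _ ι g x h
    rw [Nat.cast_succ, contDiffAt_succ_iff_hasFDerivAt] at h ⊢
    obtain ⟨f', ⟨u, hu, hd⟩, hf'⟩ := h
    have : ∀ y, ∃ L' : E →L[ℝ] P, y ∈ u →
        ι.toContinuousLinearMap.comp L' = f' y ∧ HasFDerivAt g L' y := by
      intro y
      by_cases hy : y ∈ u
      · obtain ⟨L', h1, h2⟩ := HasFDerivAt.exists_of_linearIsometry_comp ι (hd y hy)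
        exact ⟨L', fun _ => ⟨h1, h2⟩⟩
      · exact ⟨0, fun h => absurd h hy⟩
    choose g' hg' using this
    refine ⟨g', ⟨u, hu, fun y hy => (hg' y hy).2⟩, ?_⟩
    refine ih (ι.postcompL E) (hf'.congr_of_eventuallyEq ?_)
    filter_upwards [hu] with y hy
    exact (hg' y hy).1

/-- Smoothness is reflected by linear isometries from a complete space. -/
theorem ContDiffAt.of_linearIsometry_comp.{u} {E P F : Type u} [NormedAddCommGroup E] [NormedSpace ℝ E]
    [NormedAddCommGroup P] [NormedSpace ℝ P] [NormedAddCommGroup F] [NormedSpace ℝ F]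
    [CompleteSpace P] (ι : P →ₗᵢ[ℝ] F) {g : E → P} {x : E}
    (h : ContDiffAt ℝ ∞ (fun z => ι (g z)) x) : ContDiffAt ℝ ∞ g x :=
  contDiffAt_infty.2 fun n => ContDiffAt.of_linearIsometry_comp_nat n ι (contDiffAt_infty.1 h n)

theorem ContMDiffAt.of_linearIsometry_comp.{u, v, w} {E : Type u} [NormedAddCommGroup E]
    [NormedSpace ℝ E] {H : Type v} [TopologicalSpace H] {I : ModelWithCorners ℝ E H} [I.Boundaryless]
    {M : Type w} [TopologicalSpace M] [ChartedSpace H M] {P F : Type u}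
    [NormedAddCommGroup P] [NormedSpace ℝ P] [NormedAddCommGroup F] [NormedSpace ℝ F]
    [CompleteSpace P] (ι : P →ₗᵢ[ℝ] F) {g : M → P} {x : M}
    (h : ContMDiffAt I 𝓘(ℝ, F) ∞ (fun z => ι (g z)) x) : ContMDiffAt I 𝓘(ℝ, P) ∞ g x := by
  rw [contMDiffAt_iff] at h ⊢
  refine ⟨ι.isometry.isEmbedding.continuousAt_iff.2 h.1, ?_⟩
  have h2 := h.2
  rw [I.range_eq_univ, contDiffWithinAt_univ] at h2 ⊢
  exact ContDiffAt.of_linearIsometry_comp ι h2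

/-! ### Lie group structure from a flattening chart -/

/-- A chart of the unit group of a Banach algebra around `1` that flattens the subgroup `S`
onto the subspace `𝔰`. -/
structure FlatteningChart {B : Type*} [NormedRing B] [NormedAlgebra ℝ B]
    (S : Subgroup Bˣ) (𝔰 : Submodule ℝ B) where
  chart : OpenPartialHomeomorph Bˣ B
  extension : B → B
  one_mem : 1 ∈ chart.source
  map_one : chart 1 = 0
  extension_eq : ∀ u ∈ chart.source, chart u = extension u
  contDiffAt_extension : ∀ u ∈ chart.source, ContDiffAt ℝ ∞ extension (u : B)
  contDiffAt_symm : ∀ X ∈ chart.target, ContDiffAt ℝ ∞ (fun X => (chart.symm X : B)) X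
  hasFDerivAt_symm :
    HasFDerivAt (fun X => (chart.symm X : B)) (ContinuousLinearMap.id ℝ B) 0
  mem_iff : ∀ u ∈ chart.source, u ∈ S ↔ chart u ∈ 𝔰

namespace FlatteningChart

variable {B : Type*} [NormedRing B] [NormedAlgebra ℝ B]
    {S : Subgroup Bˣ} {𝔰 : Submodule ℝ B} (D : FlatteningChart S 𝔰)

open Classical in
/-- The chart of the subgroup around `1`. -/
noncomputable def chartOne : OpenPartialHomeomorph S 𝔰 where
  -- The values `0` here and `1` in the inverse are only used outside the source and the target.
  toFun s := if h : D.chart s ∈ 𝔰 then ⟨D.chart s, h⟩ else 0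
  invFun X := if h : D.chart.symm X ∈ S then ⟨D.chart.symm X, h⟩ else 1
  source := {s | (s : Bˣ) ∈ D.chart.source}
  target := {X | (X : B) ∈ D.chart.target}
  map_source' s hs := by
    have h : D.chart s ∈ 𝔰 := (D.mem_iff _ hs).1 s.2
    simpa [h] using D.chart.map_source hs
  map_target' X hX := by
    have h : D.chart.symm X ∈ S := by
      rw [D.mem_iff _ (D.chart.map_target hX), D.chart.right_inv hX]
      exact X.2
    simpa [h] using D.chart.map_target hX
  left_inv' s hs := by
    have h : D.chart s ∈ 𝔰 := (D.mem_iff _ hs).1 s.2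
    simp [h, D.chart.left_inv hs]
  right_inv' X hX := by
    have h : D.chart.symm X ∈ S := by
      rw [D.mem_iff _ (D.chart.map_target hX), D.chart.right_inv hX]
      exact X.2
    simp [h, D.chart.right_inv hX]
  open_source := D.chart.open_source.preimage continuous_subtype_val
  open_target := D.chart.open_target.preimage continuous_subtype_val
  continuousOn_toFun := by
    rw [Topology.IsEmbedding.subtypeVal.continuousOn_iff]
    refine (D.chart.continuousOn.comp continuous_subtype_val.continuousOn
      (fun s hs => hs)).congr fun s hs => ?_
    have h : D.chart s ∈ 𝔰 := (D.mem_iff _ hs).1 s.2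
    simp [h]
  continuousOn_invFun := by
    rw [Topology.IsEmbedding.subtypeVal.continuousOn_iff]
    refine (D.chart.continuousOn_symm.comp continuous_subtype_val.continuousOn
      (fun s hs => hs)).congr fun X hX => ?_
    have h : D.chart.symm X ∈ S := by
      rw [D.mem_iff _ (D.chart.map_target hX), D.chart.right_inv hX]
      exact X.2
    simp [h]

theorem coe_chartOne {s : S} (hs : s ∈ D.chartOne.source) :
    (D.chartOne s : B) = D.extension (s : Bˣ) := by
  have h : D.chart s ∈ 𝔰 := (D.mem_iff _ hs).1 s.2
  rw [← D.extension_eq _ hs]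
  simp [chartOne, h]

theorem coe_chartOne_symm {X : 𝔰} (hX : X ∈ D.chartOne.target) :
    (D.chartOne.symm X : Bˣ) = D.chart.symm X := by
  have h : D.chart.symm X ∈ S := by
    rw [D.mem_iff _ (D.chart.map_target hX), D.chart.right_inv hX]
    exact X.2
  simp [chartOne, h]

theorem one_mem_chartOne_source : (1 : S) ∈ D.chartOne.source := D.one_mem

theorem chartOne_one : D.chartOne 1 = 0 := by
  apply Subtype.ext
  rw [D.coe_chartOne D.one_mem_chartOne_source]
  exact (D.extension_eq _ D.one_mem).symm.trans D.map_one

/-- The chart of the subgroup around `g`, obtained by left translation. -/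
noncomputable def chartAt (g : S) : OpenPartialHomeomorph S 𝔰 :=
  (Homeomorph.mulLeft g⁻¹).toOpenPartialHomeomorph.trans D.chartOne

theorem mem_chartAt_source {g s : S} :
    s ∈ (D.chartAt g).source ↔ g⁻¹ * s ∈ D.chartOne.source := by
  simp [chartAt]

theorem mem_chartAt_target {g : S} {X : 𝔰} :
    X ∈ (D.chartAt g).target ↔ X ∈ D.chartOne.target := by
  simp [chartAt]

theorem coe_chartAt {g s : S} (hs : s ∈ (D.chartAt g).source) :
    (D.chartAt g s : B) = D.extension (((g⁻¹ : S) : Bˣ) * (s : Bˣ) : B) := by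
  rw [mem_chartAt_source] at hs
  have := D.coe_chartOne hs
  simpa [chartAt] using this

theorem coe_chartAt_symm {g : S} {X : 𝔰} (hX : X ∈ (D.chartAt g).target) :
    (((D.chartAt g).symm X : Bˣ) : B) = ((g : Bˣ) : B) * D.chart.symm X := by
  rw [mem_chartAt_target] at hX
  rw [← D.coe_chartOne_symm hX]
  have h : (D.chartAt g).symm X = g * D.chartOne.symm X := by
    simp [chartAt, Homeomorph.mulLeft_symm]
  rw [h]
  simp

/-- The charted space structure given by the left translates of the chart around `1`. -/
@[reducible] noncomputable def chartedSpace : ChartedSpace 𝔰 S where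
  atlas := Set.range D.chartAt
  chartAt := D.chartAt
  mem_chart_source g := by
    rw [mem_chartAt_source, inv_mul_cancel]
    exact D.one_mem_chartOne_source
  chart_mem_atlas g := ⟨g, rfl⟩

theorem contDiffAt_chartAt_symm (g : S) {X : 𝔰} (hX : X ∈ (D.chartAt g).target) :
    ContDiffAt ℝ ∞ (fun X => (((D.chartAt g).symm X : Bˣ) : B)) X := by
  have h1 : ContDiffAt ℝ ∞ (fun X : 𝔰 => ((g : Bˣ) : B) * D.chart.symm X) X := by
    refine contDiffAt_const.mul ?_
    exact (D.contDiffAt_symm X (D.mem_chartAt_target.1 hX)).comp X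
      𝔰.subtypeL.contDiff.contDiffAt
  refine h1.congr_of_eventuallyEq ?_
  filter_upwards [(D.chartAt g).open_target.mem_nhds hX] with Y hY
  exact D.coe_chartAt_symm hY

/-- Seen in `B`, a transition map is `extension` applied to `h⁻¹ g` times the inverse chart, hence
smooth; it takes values in the complete subspace `𝔰`, where smoothness can be tested in `B`. -/
theorem isManifold [CompleteSpace 𝔰] :
    letI := D.chartedSpace
    IsManifold 𝓘(ℝ, 𝔰) ∞ S := by
  let := D.chartedSpace
  refine isManifold_of_contDiffOn _ _ _ ?_
  rintro _ _ ⟨g, rfl⟩ ⟨h, rfl⟩ X hX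
  simp only [modelWithCornersSelf_coe, modelWithCornersSelf_coe_symm, Set.range_id, Set.inter_univ,
    Set.preimage_id_eq, id_eq, Function.comp_id, Function.id_comp] at hX ⊢
  refine ContDiffAt.contDiffWithinAt ?_
  have hX1 := hX
  rw [OpenPartialHomeomorph.trans_source] at hX1
  refine ContDiffAt.of_linearIsometry_comp 𝔰.subtypeₗᵢ ?_
  have h2 : ContDiffAt ℝ ∞
      (fun Y => D.extension ((((h⁻¹ : S) : Bˣ) : B) * (((D.chartAt g).symm Y : Bˣ) : B))) X := by
    have hF : ContDiffAt ℝ ∞ D.extension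
        ((((h⁻¹ : S) : Bˣ) : B) * (((D.chartAt g).symm X : Bˣ) : B)) :=
      D.contDiffAt_extension (h⁻¹ * (D.chartAt g).symm X : S) (D.mem_chartAt_source.1 hX1.2)
    exact hF.comp X (contDiffAt_const.mul (D.contDiffAt_chartAt_symm g hX1.1))
  refine h2.congr_of_eventuallyEq ?_
  filter_upwards [((D.chartAt g).symm.trans (D.chartAt h)).open_source.mem_nhds hX] with Y hY
  rw [OpenPartialHomeomorph.trans_source] at hY
  exact D.coe_chartAt hY.2

theorem contMDiff_coe [CompleteSpace 𝔰] :
    letI := D.chartedSpace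
    ContMDiff 𝓘(ℝ, 𝔰) 𝓘(ℝ, B) ∞ (fun s : S => ((s : Bˣ) : B)) := by
  let := D.chartedSpace
  have := D.isManifold
  intro s
  have hs : s ∈ (D.chartAt s).source := ChartedSpace.mem_chart_source s
  have h1 : ContMDiffAt 𝓘(ℝ, 𝔰) 𝓘(ℝ, 𝔰) ∞ (D.chartAt s) s :=
    (contMDiffOn_chart (x := s)).contMDiffAt ((D.chartAt s).open_source.mem_nhds hs)
  have h2 := (D.contDiffAt_chartAt_symm s ((D.chartAt s).map_source hs)).contMDiffAt.comp s h1
  refine h2.congr_of_eventuallyEq ?_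
  filter_upwards [(D.chartAt s).open_source.mem_nhds hs] with t ht
  simp [(D.chartAt s).left_inv ht]

/-- This reduces smoothness of the group operations to smoothness in the algebra `B`. Continuity
keeps `f` inside one chart domain, where the chart is the restriction of a smooth function on `B`.
-/
theorem contMDiffAt_of_coe.{u, v, w} {B : Type u} [NormedRing B] [NormedAlgebra ℝ B]
    {S : Subgroup Bˣ} {𝔰 : Submodule ℝ B} (D : FlatteningChart S 𝔰) [CompleteSpace 𝔰]
    {E : Type u} [NormedAddCommGroup E]
    [NormedSpace ℝ E] {H : Type v} [TopologicalSpace H] {I : ModelWithCorners ℝ E H} [I.Boundaryless]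
    {M : Type w} [TopologicalSpace M] [ChartedSpace H M] {f : M → S} {x : M}
    (hc : ContinuousAt f x) (hf : ContMDiffAt I 𝓘(ℝ, B) ∞ (fun y => ((f y : Bˣ) : B)) x) :
    letI := D.chartedSpace
    ContMDiffAt I 𝓘(ℝ, 𝔰) ∞ f x := by
  let := D.chartedSpace
  have := D.isManifold
  set g := f x with hg
  have hs : f x ∈ (D.chartAt g).source := ChartedSpace.mem_chart_source (f x)
  have hev : ∀ᶠ y in 𝓝 x, f y ∈ (D.chartAt g).source :=
    hc ((D.chartAt g).open_source.mem_nhds hs)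
  have h1 : ContMDiffAt I 𝓘(ℝ, 𝔰) ∞ (fun y => D.chartAt g (f y)) x := by
    refine ContMDiffAt.of_linearIsometry_comp 𝔰.subtypeₗᵢ ?_
    have hF : ContDiffAt ℝ ∞ D.extension
        ((((g⁻¹ : S) : Bˣ) : B) * ((f x : Bˣ) : B)) :=
      D.contDiffAt_extension (g⁻¹ * f x : S) (D.mem_chartAt_source.1 hs)
    have hF2 : ContDiffAt ℝ ∞ (fun b => D.extension ((((g⁻¹ : S) : Bˣ) : B) * b))
        ((f x : Bˣ) : B) :=
      ContDiffAt.comp _ hF (contDiffAt_const.mul contDiffAt_id)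
    refine (hF2.contMDiffAt.comp x hf).congr_of_eventuallyEq ?_
    filter_upwards [hev] with y hy
    exact D.coe_chartAt hy
  have h2 : ContMDiffAt 𝓘(ℝ, 𝔰) 𝓘(ℝ, 𝔰) ∞ (D.chartAt g).symm (D.chartAt g (f x)) :=
    (contMDiffOn_chart_symm (x := g)).contMDiffAt
      ((D.chartAt g).open_target.mem_nhds ((D.chartAt g).map_source hs))
  refine (h2.comp x h1).congr_of_eventuallyEq ?_
  filter_upwards [hev] with y hy
  simp [(D.chartAt g).left_inv hy]

theorem lieGroup [CompleteSpace B] [CompleteSpace 𝔰] :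
    letI := D.chartedSpace
    LieGroup 𝓘(ℝ, 𝔰) ∞ S := by
  let := D.chartedSpace
  have := D.isManifold
  have hm : ContMDiff (𝓘(ℝ, 𝔰).prod 𝓘(ℝ, 𝔰)) 𝓘(ℝ, 𝔰) ∞ (fun p : S × S => p.1 * p.2) := by
    intro p
    refine D.contMDiffAt_of_coe continuous_mul.continuousAt ?_
    have h1 := (D.contMDiff_coe.comp (contMDiff_fst (I := 𝓘(ℝ, 𝔰)) (J := 𝓘(ℝ, 𝔰)) (N := S))) p
    have h2 := (D.contMDiff_coe.comp (contMDiff_snd (I := 𝓘(ℝ, 𝔰)) (J := 𝓘(ℝ, 𝔰)) (M := S))) p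
    have h3 : ContDiff ℝ ∞ (fun q : B × B => q.1 * q.2) := contDiff_mul
    exact h3.contMDiff.contMDiffAt.comp p (h1.prodMk_space h2)
  have : ContMDiffMul 𝓘(ℝ, 𝔰) ∞ S := { contMDiff_mul := hm }
  refine { contMDiff_inv := ?_ }
  intro s
  refine D.contMDiffAt_of_coe continuous_inv.continuousAt ?_
  have h3 := (contDiffAt_ringInverse ℝ (s : Bˣ) (n := ∞)).contMDiffAt.comp s (D.contMDiff_coe s)
  refine h3.congr_of_eventuallyEq (Eventually.of_forall fun t => ?_)
  simp
end FlatteningChart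

/-! ### The bracket of left-invariant fields as a commutator -/

/-- The Lie bracket of vector fields which are related by `Ψ` to vector fields along `Ψ`. -/
theorem fderiv_lieBracket_of_related {E F : Type*} [NormedAddCommGroup E] [NormedSpace ℝ E]
    [NormedAddCommGroup F] [NormedSpace ℝ F] {Ψ : E → F} {v w : E → E} {V W : E → F}
    {V' W' : E →L[ℝ] F} {x : E}
    (hΨ : ContDiffAt ℝ 2 Ψ x) (hv : DifferentiableAt ℝ v x) (hw : DifferentiableAt ℝ w x)
    (hV : HasFDerivAt V V' x) (hW : HasFDerivAt W W' x)
    (hvV : ∀ᶠ y in 𝓝 x, fderiv ℝ Ψ y (v y) = V y) (hwW : ∀ᶠ y in 𝓝 x, fderiv ℝ Ψ y (w y) = W y) :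
    fderiv ℝ Ψ x (lieBracket ℝ v w x) = W' (v x) - V' (w x) := by
  have hD : DifferentiableAt ℝ (fderiv ℝ Ψ) x :=
    (hΨ.fderiv_right (m := 1) (by norm_num)).differentiableAt one_ne_zero
  have hsymm : IsSymmSndFDerivAt ℝ Ψ x := hΨ.isSymmSndFDerivAt (by simp)
  have key : ∀ {u : E → E} {U : E → F} {U' : E →L[ℝ] F}, DifferentiableAt ℝ u x →
      HasFDerivAt U U' x → (∀ᶠ y in 𝓝 x, fderiv ℝ Ψ y (u y) = U y) →
      ∀ z, U' z = fderiv ℝ (fderiv ℝ Ψ) x z (u x) + fderiv ℝ Ψ x (fderiv ℝ u x z) := by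
    intro u U U' hu hU hev z
    have h1 := hD.hasFDerivAt.clm_apply hu.hasFDerivAt
    have h2 := (hU.congr_of_eventuallyEq hev).unique h1
    rw [h2]
    simp [add_comm]
  -- The two second-derivative terms differ only in the order of the arguments, so they cancel by
  -- symmetry.
  rw [key hw hW hwW, key hv hV hvV, lieBracket, map_sub, hsymm (w x) (v x)]
  abel

section LieGroupHom

variable {E : Type*} [NormedAddCommGroup E] [NormedSpace ℝ E]
  {G : Type*} [TopologicalSpace G] [ChartedSpace E G] [Group G]
  {B : Type*} [NormedRing B] [NormedAlgebra ℝ B] {ι : G →* B}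

/-- The derivative at `g` of a map from `G` to a Banach algebra. -/
noncomputable def derivInto (ι : G → B) (g : G) : TangentSpace 𝓘(ℝ, E) g →L[ℝ] B :=
  mfderiv 𝓘(ℝ, E) 𝓘(ℝ, B) ι g

/-- Differentiate `ι (g x) = ι g * ι x` at `x = 1`. -/
theorem derivInto_mul_left [LieGroup 𝓘(ℝ, E) ∞ G] (hι : ContMDiff 𝓘(ℝ, E) 𝓘(ℝ, B) ∞ ι)
    (g : G) (X : GroupLieAlgebra 𝓘(ℝ, E) G) :
    derivInto ι g (mulInvariantVectorField X g) = ι g * derivInto ι 1 X := by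
  have hd : MDifferentiable 𝓘(ℝ, E) 𝓘(ℝ, B) ι := hι.mdifferentiable (by simp)
  have hl : MDifferentiableAt 𝓘(ℝ, E) 𝓘(ℝ, E) (g * ·) (1 : G) :=
    (contMDiff_mul_left (I := 𝓘(ℝ, E)) (n := ∞)).mdifferentiable (by simp) 1
  have h1 : HasMFDerivAt 𝓘(ℝ, E) 𝓘(ℝ, B) (ι ∘ (g * ·)) (1 : G)
      ((mfderiv 𝓘(ℝ, E) 𝓘(ℝ, B) ι g).comp (mfderiv 𝓘(ℝ, E) 𝓘(ℝ, E) (g * ·) (1 : G))) := by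
    have h : ∀ y, y = g → HasMFDerivAt 𝓘(ℝ, E) 𝓘(ℝ, B) ι y
        (mfderiv 𝓘(ℝ, E) 𝓘(ℝ, B) ι g : E →L[ℝ] B) := by
      rintro _ rfl
      exact (hd _).hasMFDerivAt
    exact (h (g * 1) (mul_one g)).comp (1 : G) hl.hasMFDerivAt
  have h2 : HasMFDerivAt 𝓘(ℝ, E) 𝓘(ℝ, B) ((fun b : B => ι g * b) ∘ ι) (1 : G)
      ((ContinuousLinearMap.mul ℝ B (ι g)).comp (mfderiv 𝓘(ℝ, E) 𝓘(ℝ, B) ι 1)) :=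
    ((ContinuousLinearMap.mul ℝ B (ι g)).hasFDerivAt.hasMFDerivAt).comp (1 : G) (hd 1).hasMFDerivAt
  have h3 : (ι ∘ (g * ·)) = (fun b : B => ι g * b) ∘ ι := by
    ext x
    simp
  rw [h3] at h1
  exact congrArg (fun L => L X) (hasMFDerivAt_unique h1 h2)

/-- The derivative at `1` of a smooth homomorphism from a Lie group to a Banach algebra
transforms the Lie bracket into the commutator. -/
theorem derivInto_lie [CompleteSpace E] [LieGroup 𝓘(ℝ, E) ∞ G]
    (hι : ContMDiff 𝓘(ℝ, E) 𝓘(ℝ, B) ∞ ι) (X Y : GroupLieAlgebra 𝓘(ℝ, E) G) :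
    derivInto ι 1 ⁅X, Y⁆ =
      derivInto ι 1 X * derivInto ι 1 Y - derivInto ι 1 Y * derivInto ι 1 X := by
  have : LieGroup 𝓘(ℝ, E) (minSmoothness ℝ 3) G :=
    LieGroup.of_le (n := ∞) (by simp; exact ENat.LEInfty.out)
  have hd : MDifferentiable 𝓘(ℝ, E) 𝓘(ℝ, B) ι := hι.mdifferentiable (by simp)
  set φ := extChartAt 𝓘(ℝ, E) (1 : G) with hφ
  set x₀ : E := φ 1 with hx₀
  set Ψ : E → B := fun x => ι (φ.symm x) with hΨdef
  have htgt : φ.target ∈ 𝓝 x₀ := extChartAt_target_mem_nhds 1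
  have hΨ : ContDiffAt ℝ 2 Ψ x₀ := by
    have h1 : ContMDiffAt 𝓘(ℝ, E) 𝓘(ℝ, E) ∞ φ.symm x₀ :=
      (contMDiffOn_extChartAt_symm (1 : G)).contMDiffAt htgt
    have h2 := (hι.contMDiffAt (x := φ.symm x₀)).comp x₀ h1
    exact (contMDiffAt_iff_contDiffAt.1 h2).of_le ENat.LEInfty.out
  have hsymm : ∀ y ∈ φ.target, MDifferentiableAt 𝓘(ℝ, E) 𝓘(ℝ, E) φ.symm y := fun y hy => by
    have := mdifferentiableWithinAt_extChartAt_symm hy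
    rwa [modelWithCornersSelf_coe, Set.range_id, mdifferentiableWithinAt_univ] at this
  have hΨd : ∀ y ∈ φ.target, fderiv ℝ Ψ y =
      (mfderiv 𝓘(ℝ, E) 𝓘(ℝ, B) ι (φ.symm y)).comp (mfderiv 𝓘(ℝ, E) 𝓘(ℝ, E) φ.symm y) := by
    intro y hy
    rw [← mfderiv_eq_fderiv]
    exact mfderiv_comp y (hd _) (hsymm y hy)
  -- In the chart, the left-invariant field of `Z` is related through `Ψ` to `Ψ` times a constant
  -- element of `B`, a field along `Ψ` whose derivative is explicit.
  have hfield : ∀ Z : GroupLieAlgebra 𝓘(ℝ, E) G, ∀ y ∈ φ.target,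
      fderiv ℝ Ψ y (mpullbackWithin 𝓘(ℝ, E) 𝓘(ℝ, E) φ.symm (mulInvariantVectorField Z)
        (Set.range 𝓘(ℝ, E)) y) = Ψ y * derivInto ι 1 Z := by
    intro Z y hy
    have hinv := isInvertible_mfderivWithin_extChartAt_symm (I := 𝓘(ℝ, E)) hy
    rw [mpullbackWithin_apply, hΨd y hy]
    have h2 := hinv.self_apply_inverse (mulInvariantVectorField Z (φ.symm y))
    rw [← derivInto_mul_left hι]
    have h3 : mfderivWithin 𝓘(ℝ, E) 𝓘(ℝ, E) φ.symm (Set.range 𝓘(ℝ, E)) y =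
        mfderiv 𝓘(ℝ, E) 𝓘(ℝ, E) φ.symm y := by
      rw [modelWithCornersSelf_coe, Set.range_id, mfderivWithin_univ]
    rw [h3] at h2 ⊢
    exact congrArg (mfderiv 𝓘(ℝ, E) 𝓘(ℝ, B) ι (φ.symm y)) h2
  have hdiff : ∀ Z : GroupLieAlgebra 𝓘(ℝ, E) G, DifferentiableAt ℝ
      (mpullbackWithin 𝓘(ℝ, E) 𝓘(ℝ, E) φ.symm (mulInvariantVectorField Z)
        (Set.range 𝓘(ℝ, E))) x₀ := by
    intro Z
    have h := (mdifferentiableAt_mulInvariantVectorField Z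
      (g := (1 : G))).mdifferentiableWithinAt (s := Set.univ)
    have := MDifferentiableWithinAt.differentiableWithinAt_mpullbackWithin_vectorField h
    rw [Set.preimage_univ, Set.univ_inter, 𝓘(ℝ, E).range_eq_univ] at this
    rw [𝓘(ℝ, E).range_eq_univ]
    exact differentiableWithinAt_univ.1 this
  have hx₀' : φ.symm x₀ = 1 := extChartAt_to_inv (I := 𝓘(ℝ, E)) (1 : G)
  have hid : ∀ (L : E →L[ℝ] E) (z : E), L = ContinuousLinearMap.id ℝ E → L.inverse z = z := by
    rintro _ z rfl
    simp
  have hval : ∀ Z : GroupLieAlgebra 𝓘(ℝ, E) G,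
      mpullbackWithin 𝓘(ℝ, E) 𝓘(ℝ, E) φ.symm (mulInvariantVectorField Z)
        (Set.range 𝓘(ℝ, E)) x₀ = Z := by
    intro Z
    have h : ∀ g : G, g = 1 → (mulInvariantVectorField Z g : E) = (Z : E) := by
      rintro _ rfl
      have h1 : ((1 : G) * ·) = (id : G → G) := by ext; simp
      rw [mulInvariantVectorField, h1, mfderiv_id]
      rfl
    have h2 : (mulInvariantVectorField Z (φ.symm x₀) : E) = Z := h _ hx₀'
    exact (hid _ _ (mfderivWithin_range_extChartAt_symm (I := 𝓘(ℝ, E)) (x := (1 : G)))).trans h2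
  have hΨ₀ : fderiv ℝ Ψ x₀ = derivInto ι 1 := by
    have h : ∀ g : G, g = 1 → (mfderiv 𝓘(ℝ, E) 𝓘(ℝ, B) ι g : E →L[ℝ] B) = derivInto ι 1 := by
      rintro _ rfl
      rfl
    have h1 := mfderivWithin_range_extChartAt_symm (I := 𝓘(ℝ, E)) (x := (1 : G))
    rw [𝓘(ℝ, E).range_eq_univ, mfderivWithin_univ] at h1
    have h2 := hΨd x₀ (mem_of_mem_nhds htgt)
    rw [h1] at h2
    exact h2.trans (h _ hx₀')
  have hmul : ∀ b : B, HasFDerivAt (fun y => Ψ y * b)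
      (((ContinuousLinearMap.mul ℝ B).flip b).comp (fderiv ℝ Ψ x₀)) x₀ := fun b =>
    ((ContinuousLinearMap.mul ℝ B).flip b).hasFDerivAt.comp x₀
      (hΨ.differentiableAt (by simp)).hasFDerivAt
  -- Writing `x`, `y` for the images of `X`, `Y` in `B`: the derivative of `Ψ * y` along `X` is `x *
  -- y`, that of `Ψ * x` along `Y` is `y * x`, and their difference is the commutator.
  have key := fderiv_lieBracket_of_related hΨ (hdiff X) (hdiff Y) (hmul _) (hmul _)
    (eventually_of_mem htgt (hfield X)) (eventually_of_mem htgt (hfield Y))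
  have hbr : (⁅X, Y⁆ : GroupLieAlgebra 𝓘(ℝ, E) G) =
      lieBracket ℝ (mpullbackWithin 𝓘(ℝ, E) 𝓘(ℝ, E) φ.symm (mulInvariantVectorField X)
        (Set.range 𝓘(ℝ, E))) (mpullbackWithin 𝓘(ℝ, E) 𝓘(ℝ, E) φ.symm (mulInvariantVectorField Y)
        (Set.range 𝓘(ℝ, E))) x₀ := by
    rw [GroupLieAlgebra.bracket_def, mlieBracket, mlieBracketWithin_apply]
    refine (hid _ _ (mfderiv_extChartAt_self (I := 𝓘(ℝ, E)) (x := (1 : G)))).trans ?_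
    rw [Set.preimage_univ, Set.univ_inter, 𝓘(ℝ, E).range_eq_univ]
    exact congrFun lieBracketWithin_univ x₀
  rw [hval, hval, hΨ₀, ← hbr] at key
  exact key
end LieGroupHom

/-! ### Identification of the Lie algebra of a flattened subgroup -/

section

variable {E : Type*} [NormedAddCommGroup E] [NormedSpace ℝ E]
  {M : Type*} [TopologicalSpace M] [ChartedSpace E M]
  {B : Type*} [NormedRing B] [NormedAlgebra ℝ B] [CompleteSpace B]

/-- The unit group is open in `B` and its chart is the inclusion, so the two smoothness conditions
have the same coordinate expression. -/
theorem ContMDiffAt.units_of_val {E' : Type*} [NormedAddCommGroup E'] [NormedSpace ℝ E']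
    {H' : Type*} [TopologicalSpace H'] {I : ModelWithCorners ℝ E' H'}
    {M : Type*} [TopologicalSpace M] [ChartedSpace H' M] {f : M → Bˣ} {x : M}
    (hf : ContMDiffAt I 𝓘(ℝ, B) ∞ (fun y => (f y : B)) x) :
    ContMDiffAt I 𝓘(ℝ, B) ∞ f x := by
  rw [contMDiffAt_iff] at hf ⊢
  exact ⟨Units.isOpenEmbedding_val.isEmbedding.continuousAt_iff.2 hf.1, hf.2⟩

theorem mfderiv_units_eq_derivInto {f : M → Bˣ} (hf : ContMDiff 𝓘(ℝ, E) 𝓘(ℝ, B) ∞ f) (x : M) :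
    (mfderiv 𝓘(ℝ, E) 𝓘(ℝ, B) f x : TangentSpace 𝓘(ℝ, E) x →L[ℝ] B) =
      derivInto (fun y => (f y : B)) x := by
  have h1 : MDifferentiableAt 𝓘(ℝ, E) 𝓘(ℝ, B) f x := hf.mdifferentiable (by simp) x
  have h2 : MDifferentiableAt 𝓘(ℝ, E) 𝓘(ℝ, B) (fun y => (f y : B)) x :=
    (Units.contMDiff_val.comp hf).mdifferentiable (by simp) x
  exact h1.mfderiv.trans h2.mfderiv.symm

end

namespace FlatteningChart

variable {B : Type*} [NormedRing B] [NormedAlgebra ℝ B]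
    {S : Subgroup Bˣ} {𝔰 : Submodule ℝ B} [CompleteSpace 𝔰] (D : FlatteningChart S 𝔰)

theorem contMDiff_incl [CompleteSpace B] :
    letI := D.chartedSpace
    ContMDiff 𝓘(ℝ, 𝔰) 𝓘(ℝ, B) ∞ (fun s : S => (s : Bˣ)) := by
  let := D.chartedSpace
  exact fun s => (D.contMDiff_coe s).units_of_val

/-- The chart sends `1` to `0` and its inverse has derivative the identity there, so the model space
`𝔰` is the tangent space at `1` without any further identification. -/
theorem derivInto_coe_one (X : 𝔰) :
    letI := D.chartedSpace
    derivInto (E := 𝔰) (fun s : S => ((s : Bˣ) : B)) 1 X = (X : B) := by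
  let := D.chartedSpace
  have h1 : MDifferentiableAt 𝓘(ℝ, 𝔰) 𝓘(ℝ, B) (fun s : S => ((s : Bˣ) : B)) 1 :=
    D.contMDiff_coe.mdifferentiable (by simp) 1
  have h0 : D.chartAt 1 1 = 0 := by
    simp [chartAt, D.chartOne_one]
  have htgt : (0 : 𝔰) ∈ (D.chartAt 1).target := by
    rw [← h0]
    exact (D.chartAt 1).map_source (ChartedSpace.mem_chart_source (1 : S))
  have h2 : HasFDerivAt (fun X : 𝔰 => (((D.chartAt 1).symm X : Bˣ) : B)) 𝔰.subtypeL 0 := by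
    have h3 : HasFDerivAt (fun X => (D.chart.symm X : B)) (ContinuousLinearMap.id ℝ B)
        (𝔰.subtypeL 0) := by
      rw [map_zero]
      exact D.hasFDerivAt_symm
    have h4 := h3.comp (0 : 𝔰) 𝔰.subtypeL.hasFDerivAt
    rw [ContinuousLinearMap.id_comp] at h4
    refine h4.congr_of_eventuallyEq ?_
    filter_upwards [(D.chartAt 1).open_target.mem_nhds htgt] with Y hY
    rw [D.coe_chartAt_symm hY]
    simp
  have h5 : fderivWithin ℝ (writtenInExtChartAt 𝓘(ℝ, 𝔰) 𝓘(ℝ, B) 1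
      (fun s : S => ((s : Bˣ) : B))) (Set.range 𝓘(ℝ, 𝔰)) (extChartAt 𝓘(ℝ, 𝔰) (1 : S) 1) =
      𝔰.subtypeL := by
    rw [𝓘(ℝ, 𝔰).range_eq_univ, fderivWithin_univ]
    have h6 : extChartAt 𝓘(ℝ, 𝔰) (1 : S) 1 = 0 := h0
    rw [h6]
    exact h2.fderiv
  exact congrArg (fun L => L X) (h1.mfderiv.trans h5)

end FlatteningChart

variable {H : Type*} [NormedAddCommGroup H] [InnerProductSpace ℂ H] [CompleteSpace H]

theorem FlatteningChart.isLieGroupWithLieAlgebra {S : Subgroup (GLH H)}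
    {𝔰 : LieSubalgebra ℝ (H →L[ℂ] H)} (D : FlatteningChart S 𝔰.toSubmodule)
    (h : IsClosed (𝔰 : Set (H →L[ℂ] H))) :
    letI := D.chartedSpace
    IsLieGroupWithLieAlgebra S 𝔰 := by
  let := D.chartedSpace
  have : CompleteSpace 𝔰.toSubmodule := h.completeSpace_coe
  have hL := D.lieGroup
  have hι : ContMDiff 𝓘(ℝ, 𝔰.toSubmodule) 𝓘(ℝ, H →L[ℂ] H) ∞
      ((Units.coeHom (H →L[ℂ] H)).comp S.subtype) := D.contMDiff_coe
  refine ⟨hL, D.contMDiff_incl, ContinuousLinearEquiv.refl ℝ 𝔰.toSubmodule, ?_, ?_⟩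
  · intro X
    exact (congrArg (fun L => L X) (mfderiv_units_eq_derivInto D.contMDiff_incl 1)).trans
      (D.derivInto_coe_one X)
  · intro X Y
    have h1 := derivInto_lie hι X Y
    have h2 : ∀ Z : GroupLieAlgebra 𝓘(ℝ, 𝔰.toSubmodule) S,
        derivInto ((Units.coeHom (H →L[ℂ] H)).comp S.subtype) 1 Z =
          𝔰.toSubmodule.subtypeL Z :=
      fun Z => D.derivInto_coe_one Z
    rw [h2, h2, h2] at h1
    exact h1

/-! ### Upper triangular operators -/

section Triangular

variable {H : Type*} [NormedAddCommGroup H] [InnerProductSpace ℂ H] {κ : ℕ∞}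
  (ξ : HilbertBasis (BasisIndex κ) ℂ H)

theorem finiteDimensional_lowerSpan (j : BasisIndex κ) : FiniteDimensional ℂ (lowerSpan ξ j) := by
  refine FiniteDimensional.span_of_finite ℂ (Set.Finite.image _ ?_)
  exact Set.Finite.of_injOn (f := Subtype.val) (t := Set.Iio (j : ℕ))
    (fun l hl => hl) Subtype.val_injective.injOn (Set.finite_Iio _)

theorem inner_basis_eq_zero {i j : BasisIndex κ} (h : i ≠ j) : inner ℂ (ξ i) (ξ j) = 0 :=
  ξ.orthonormal.2 h

theorem inner_basis_self (j : BasisIndex κ) : inner ℂ (ξ j) (ξ j) = (1 : ℂ) := by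
  rw [inner_self_eq_norm_sq_to_K, ξ.orthonormal.1 j]
  simp

theorem inner_eq_zero_of_mem_lowerSpan {i j : BasisIndex κ} (h : j ≤ i) {x : H}
    (hx : x ∈ lowerSpan ξ j) : inner ℂ (ξ i) x = 0 := by
  have : lowerSpan ξ j ≤ LinearMap.ker (innerSL ℂ (ξ i) : H →ₗ[ℂ] ℂ) := by
    refine Submodule.span_le.2 ?_
    rintro _ ⟨l, hl, rfl⟩
    have hl' : l < j := hl
    exact inner_basis_eq_zero ξ (lt_of_lt_of_le hl' h).ne'
  exact this hx

theorem HilbertBasis.ext_inner {x y : H} (h : ∀ i, inner ℂ (ξ i) x = inner ℂ (ξ i) y) : x = y := by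
  apply ξ.repr.injective
  ext i
  rw [ξ.repr_apply_apply, ξ.repr_apply_apply, h]

theorem HilbertBasis.ext_clm {T S : H →L[ℂ] H} (h : ∀ j, T (ξ j) = S (ξ j)) : T = S := by
  refine ContinuousLinearMap.ext_on (s := Set.range ξ) ?_ ?_
  · rw [Submodule.dense_iff_topologicalClosure_eq_top]
    exact ξ.dense_span
  · rintro _ ⟨j, rfl⟩
    exact h j

/-- `T` is upper triangular with diagonal `r`: each `T ξ_j` lies in
`r_j ξ_j + span {ξ_l : l < j}`. -/
def UpperTriangular (r : BasisIndex κ → ℂ) (T : H →L[ℂ] H) : Prop :=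
  ∀ j, T (ξ j) - r j • ξ j ∈ lowerSpan ξ j

namespace UpperTriangular

variable {ξ} {r s : BasisIndex κ → ℂ} {T S : H →L[ℂ] H}

theorem apply_mem (hT : UpperTriangular ξ r T) {j : BasisIndex κ} {x : H}
    (hx : x ∈ lowerSpan ξ j) : T x ∈ lowerSpan ξ j := by
  have : lowerSpan ξ j ≤ (lowerSpan ξ j).comap (T : H →ₗ[ℂ] H) := by
    refine Submodule.span_le.2 ?_
    rintro _ ⟨l, hl, rfl⟩
    have h := add_mem (lowerSpan_mono ξ (le_of_lt hl) (hT l))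
      (Submodule.smul_mem _ (r l) (basis_mem_lowerSpan ξ hl))
    simpa using h
  exact this hx

theorem mul (hT : UpperTriangular ξ r T) (hS : UpperTriangular ξ s S) :
    UpperTriangular ξ (fun j => r j * s j) (T * S) := by
  intro j
  have h := add_mem (hT.apply_mem (hS j)) (Submodule.smul_mem _ (s j) (hT j))
  have h2 : T (S (ξ j) - s j • ξ j) + s j • (T (ξ j) - r j • ξ j) =
      (T * S) (ξ j) - (r j * s j) • ξ j := by
    rw [map_sub, map_smul, smul_sub, smul_smul, mul_comm (s j)]
    simp
  rwa [h2] at h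

theorem add (hT : UpperTriangular ξ r T) (hS : UpperTriangular ξ s S) :
    UpperTriangular ξ (fun j => r j + s j) (T + S) := by
  intro j
  have h := add_mem (hT j) (hS j)
  have h2 : T (ξ j) - r j • ξ j + (S (ξ j) - s j • ξ j) = (T + S) (ξ j) - (r j + s j) • ξ j := by
    rw [add_smul, add_apply]
    abel
  rwa [h2] at h

theorem inner_of_lt (hT : UpperTriangular ξ r T) {i j : BasisIndex κ} (h : j < i) :
    inner ℂ (ξ i) (T (ξ j)) = 0 := by
  have h1 := inner_eq_zero_of_mem_lowerSpan ξ h.le (hT j)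
  rwa [inner_sub_right, inner_smul_right, inner_basis_eq_zero ξ h.ne', mul_zero, sub_zero] at h1

theorem inner_self (hT : UpperTriangular ξ r T) (j : BasisIndex κ) :
    inner ℂ (ξ j) (T (ξ j)) = r j := by
  have h1 := inner_eq_zero_of_mem_lowerSpan ξ le_rfl (hT j)
  rwa [inner_sub_right, inner_smul_right, inner_basis_self ξ j, mul_one, sub_eq_zero] at h1

theorem norm_diag_le (hT : UpperTriangular ξ r T) (j : BasisIndex κ) : ‖r j‖ ≤ ‖T‖ := by
  rw [← hT.inner_self j]
  calc ‖inner ℂ (ξ j) (T (ξ j))‖ ≤ ‖ξ j‖ * ‖T (ξ j)‖ := norm_inner_le_norm _ _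
    _ ≤ ‖ξ j‖ * (‖T‖ * ‖ξ j‖) := by gcongr; exact T.le_opNorm _
    _ = ‖T‖ := by rw [ξ.orthonormal.1 j]; ring

/-- An injective endomorphism of the finite-dimensional space `lowerSpan ξ j` is onto, so the
inverse preserves this space too. For infinite-dimensional invariant subspaces this would fail. -/
theorem inv_apply_mem {u : (H →L[ℂ] H)ˣ} (hu : UpperTriangular ξ r (u : H →L[ℂ] H))
    {j : BasisIndex κ} {x : H} (hx : x ∈ lowerSpan ξ j) :
    ((u⁻¹ : (H →L[ℂ] H)ˣ) : H →L[ℂ] H) x ∈ lowerSpan ξ j := by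
  have hST : ∀ y, ((u⁻¹ : (H →L[ℂ] H)ˣ) : H →L[ℂ] H) ((u : H →L[ℂ] H) y) = y := fun y => by
    rw [← mul_apply_eq_comp, Units.inv_mul, one_apply_eq_self]
  have := finiteDimensional_lowerSpan ξ j
  let R : lowerSpan ξ j →ₗ[ℂ] lowerSpan ξ j :=
    ((u : H →L[ℂ] H) : H →ₗ[ℂ] H).restrict fun x hx => hu.apply_mem hx
  have hinj : Function.Injective R := by
    intro x y hxy
    have h : (u : H →L[ℂ] H) x = (u : H →L[ℂ] H) y := congrArg Subtype.val hxy
    exact Subtype.ext (by rw [← hST x, h, hST])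
  obtain ⟨y, hy⟩ := LinearMap.surjective_of_injective hinj ⟨x, hx⟩
  have hy' : (u : H →L[ℂ] H) y = x := congrArg Subtype.val hy
  rw [← hy', hST]
  exact y.2

theorem diag_ne_zero {u : (H →L[ℂ] H)ˣ} (hu : UpperTriangular ξ r (u : H →L[ℂ] H))
    (j : BasisIndex κ) : r j ≠ 0 := by
  intro h0
  have h1 := hu j
  rw [h0, zero_smul, sub_zero] at h1
  have h2 := hu.inv_apply_mem h1
  rw [← mul_apply_eq_comp, Units.inv_mul, one_apply_eq_self] at h2
  have h3 := inner_eq_zero_of_mem_lowerSpan ξ le_rfl h2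
  rw [inner_basis_self] at h3
  exact one_ne_zero h3

theorem inv {u : (H →L[ℂ] H)ˣ} (hu : UpperTriangular ξ r (u : H →L[ℂ] H)) :
    UpperTriangular ξ (fun j => (r j)⁻¹) ((u⁻¹ : (H →L[ℂ] H)ˣ) : H →L[ℂ] H) := by
  intro j
  have h := Submodule.smul_mem _ (-(r j)⁻¹) (hu.inv_apply_mem (hu j))
  rw [map_sub, map_smul, ← mul_apply_eq_comp, Units.inv_mul, one_apply_eq_self, smul_sub,
    smul_smul, neg_mul, inv_mul_cancel₀ (hu.diag_ne_zero j)] at h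
  convert! h using 1
  simp only [neg_smul, one_smul]
  abel

end UpperTriangular

variable {ξ}

/-- The entries below the diagonal vanish, skew-adjointness carries this above it, and the diagonal
entries are both real and purely imaginary. -/
theorem UpperTriangular.eq_zero_of_skew [CompleteSpace H] {r : BasisIndex κ → ℝ} {X : H →L[ℂ] H}
    (hX : UpperTriangular ξ (fun j => (r j : ℂ)) X) (hs : star X = -X) : X = 0 := by
  have hsymm : ∀ i j, inner ℂ (ξ i) (X (ξ j)) = -(starRingEnd ℂ) (inner ℂ (ξ j) (X (ξ i))) := by
    intro i j
    rw [inner_conj_symm, ← ContinuousLinearMap.adjoint_inner_right,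
      ← ContinuousLinearMap.star_eq_adjoint, hs, neg_apply, inner_neg_right,
      neg_neg]
  refine HilbertBasis.ext_clm ξ fun j => HilbertBasis.ext_inner ξ fun i => ?_
  rw [zero_apply, inner_zero_right]
  rcases lt_trichotomy i j with h | rfl | h
  · rw [hsymm, hX.inner_of_lt h]
    simp
  · have h1 := hsymm i i
    rw [hX.inner_self, Complex.conj_ofReal] at h1
    rw [hX.inner_self]
    have h2 : r i = -r i := by exact_mod_cast h1
    have h3 : r i = 0 := by linarith
    simp [h3]
  · exact hX.inner_of_lt h

/-- The adjoint equals the inverse, which is again upper triangular; hence `u` is diagonal. Its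
entries are positive, and of modulus one because `u` is isometric. -/
theorem UpperTriangular.eq_one_of_unitary [CompleteSpace H] {r : BasisIndex κ → ℝ} {u : GLH H}
    (hr : ∀ j, 0 < r j) (hu : UpperTriangular ξ (fun j => (r j : ℂ)) (u : H →L[ℂ] H))
    (hk : u ∈ groupK H) : u = 1 := by
  have hk' : star (u : H →L[ℂ] H) * u = 1 := hk
  have hstar : star (u : H →L[ℂ] H) = ((u⁻¹ : GLH H) : H →L[ℂ] H) :=
    Units.eq_inv_of_mul_eq_one_right hk'
  have hnorm : ∀ x, ‖(u : H →L[ℂ] H) x‖ = ‖x‖ := by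
    intro x
    have : inner ℂ ((u : H →L[ℂ] H) x) ((u : H →L[ℂ] H) x) = inner ℂ x x := by
      rw [← ContinuousLinearMap.adjoint_inner_right, ← ContinuousLinearMap.star_eq_adjoint,
        ← mul_apply_eq_comp, hk', one_apply_eq_self]
    rw [inner_self_eq_norm_sq_to_K, inner_self_eq_norm_sq_to_K] at this
    have h2 : ‖(u : H →L[ℂ] H) x‖ ^ 2 = ‖x‖ ^ 2 := by exact_mod_cast this
    exact (pow_left_inj₀ (norm_nonneg _) (norm_nonneg _) two_ne_zero).1 h2
  have hdiag : ∀ j, (u : H →L[ℂ] H) (ξ j) = (r j : ℂ) • ξ j := by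
    intro j
    refine HilbertBasis.ext_inner ξ fun i => ?_
    rw [inner_smul_right]
    rcases lt_trichotomy i j with h | rfl | h
    · rw [inner_basis_eq_zero ξ h.ne, mul_zero, ← ContinuousLinearMap.adjoint_inner_left,
        ← ContinuousLinearMap.star_eq_adjoint, hstar, ← inner_conj_symm, hu.inv.inner_of_lt h,
        map_zero]
    · rw [hu.inner_self, inner_basis_self, mul_one]
    · rw [hu.inner_of_lt h, inner_basis_eq_zero ξ h.ne', mul_zero]
  apply Units.ext
  refine HilbertBasis.ext_clm ξ fun j => ?_
  have h1 := hnorm (ξ j)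
  rw [hdiag, norm_smul, ξ.orthonormal.1 j, mul_one, Complex.norm_real, Real.norm_eq_abs,
    abs_of_pos (hr j)] at h1
  rw [hdiag, h1]
  simp

theorem upperTriangular_of_mem_groupN [CompleteSpace H] {n : GLH H} (hn : n ∈ groupN ξ) :
    UpperTriangular ξ (fun _ => 1) (n : H →L[ℂ] H) := by
  intro j
  rw [one_smul]
  exact hn j

theorem exists_upperTriangular_of_mem_groupA [CompleteSpace H] {a : GLH H} (ha : a ∈ groupA ξ) :
    ∃ r : BasisIndex κ → ℝ, (∀ j, 0 < r j) ∧ (∀ j, (a : H →L[ℂ] H) (ξ j) = (r j : ℂ) • ξ j) ∧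
      UpperTriangular ξ (fun j => (r j : ℂ)) (a : H →L[ℂ] H) := by
  choose r hr h using ha
  exact ⟨r, hr, h, fun j => by rw [h, sub_self]; exact zero_mem _⟩

theorem exists_diagonal (ξ : HilbertBasis (BasisIndex κ) ℂ H) {r : BasisIndex κ → ℂ} {C : ℝ}
    (hC : ∀ j, ‖r j‖ ≤ C) : ∃ T : H →L[ℂ] H, ∀ j, T (ξ j) = r j • ξ j := by
  -- The index set may be empty, in which case `C` can be negative.
  let C' := max C 0
  have hb : ∀ (x : lp (fun _ : BasisIndex κ => ℂ) 2) i, ‖r i * x i‖ ≤ ‖((C' : ℂ) • x) i‖ := by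
    intro x i
    rw [lp.coeFn_smul, Pi.smul_apply, norm_mul, norm_smul, Complex.norm_real, Real.norm_eq_abs,
      abs_of_nonneg (le_max_right _ _)]
    gcongr
    exact (hC i).trans (le_max_left _ _)
  let L : lp (fun _ : BasisIndex κ => ℂ) 2 →ₗ[ℂ] lp (fun _ : BasisIndex κ => ℂ) 2 :=
    { toFun := fun x => ⟨fun i => r i * x i, (lp.memℓp ((C' : ℂ) • x)).mono' (hb x)⟩
      map_add' := fun x y => by
        ext i
        exact mul_add _ _ _
      map_smul' := fun c x => by
        ext i
        exact mul_left_comm _ _ _ }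
  let L' := L.mkContinuous C' fun x => by
    have h1 : ‖L x‖ ≤ ‖(C' : ℂ) • x‖ := lp.norm_mono two_ne_zero (hb x)
    rwa [norm_smul, Complex.norm_real, Real.norm_eq_abs, abs_of_nonneg (le_max_right _ _)] at h1
  refine ⟨(ξ.repr.symm.toContinuousLinearEquiv : _ →L[ℂ] H).comp
    (L'.comp (ξ.repr.toContinuousLinearEquiv : H →L[ℂ] _)), fun j => ?_⟩
  refine HilbertBasis.ext_inner ξ fun i => ?_
  rw [← ξ.repr_apply_apply, ← ξ.repr_apply_apply, map_smul]
  have h1 : ξ.repr (((ξ.repr.symm.toContinuousLinearEquiv : _ →L[ℂ] H).comp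
    (L'.comp (ξ.repr.toContinuousLinearEquiv : H →L[ℂ] _))) (ξ j)) = L (ξ.repr (ξ j)) :=
    ξ.repr.apply_symm_apply _
  rw [h1]
  change r i * ξ.repr (ξ j) i = r j * ξ.repr (ξ j) i
  rw [ξ.repr_apply_apply]
  by_cases h : i = j
  · rw [h]
  · rw [inner_basis_eq_zero ξ h, mul_zero, mul_zero]

end Triangular

/-! ### Bijectivity of the multiplication map -/

section Iwasawa

variable {H : Type*} [NormedAddCommGroup H] [InnerProductSpace ℂ H] [CompleteSpace H] {κ : ℕ∞}
  (ξ : HilbertBasis (BasisIndex κ) ℂ H)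

/-- If `k a n = k' a' n'`, then `k'⁻¹ k = a' n' n⁻¹ a⁻¹` is unitary and upper triangular with
positive diagonal, hence `1`. The diagonals of `a n = a' n'` then give `a = a'`. -/
theorem iwasawaMul_injective : Function.Injective (iwasawaMul ξ) := by
  rintro ⟨k, a, n⟩ ⟨k', a', n'⟩ h
  have h : (k : GLH H) * a * n = k' * a' * n' := h
  obtain ⟨r, hr, har, hau⟩ := exists_upperTriangular_of_mem_groupA a.2
  obtain ⟨r', hr', har', hau'⟩ := exists_upperTriangular_of_mem_groupA a'.2
  have hn := upperTriangular_of_mem_groupN n.2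
  have hn' := upperTriangular_of_mem_groupN n'.2
  have h1 : ((k' : GLH H)⁻¹ * k : GLH H) = a' * n' * (n : GLH H)⁻¹ * (a : GLH H)⁻¹ := by
    rw [eq_mul_inv_iff_mul_eq, eq_mul_inv_iff_mul_eq, mul_assoc, mul_assoc, inv_mul_eq_iff_eq_mul,
      ← mul_assoc, ← mul_assoc, h]
  have h2 : UpperTriangular ξ (fun j => ((r' j * (r j)⁻¹ : ℝ) : ℂ))
      (((k' : GLH H)⁻¹ * k : GLH H) : H →L[ℂ] H) := by
    rw [h1]
    have := ((hau'.mul hn').mul hn.inv).mul hau.inv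
    convert! this using 2
    simp
  have h3 : ((k' : GLH H)⁻¹ * k : GLH H) = 1 :=
    h2.eq_one_of_unitary (fun j => mul_pos (hr' j) (inv_pos.2 (hr j)))
      (mul_mem (inv_mem k'.2) k.2)
  have hk : (k : GLH H) = k' := (inv_mul_eq_one.1 h3).symm
  rw [hk, mul_assoc, mul_assoc, mul_right_inj] at h
  have hrr : ∀ j, (r j : ℂ) = r' j := by
    intro j
    rw [← mul_one (r j : ℂ), ← mul_one (r' j : ℂ), ← (hau.mul hn).inner_self j,
      ← (hau'.mul hn').inner_self j, ← Units.val_mul, ← Units.val_mul, h]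
  have ha : (a : GLH H) = a' := by
    apply Units.ext
    refine HilbertBasis.ext_clm ξ fun j => ?_
    rw [har, har', hrr]
  rw [ha, mul_right_inj] at h
  ext1
  · exact Subtype.ext hk
  · ext1
    · exact Subtype.ext ha
    · exact Subtype.ext h

-- Gram–Schmidt on the vectors `g ξ_j`. Since `g` has dense range, the span of these vectors is
-- dense, so the orthonormalised family is a Hilbert basis and `k` is unitary rather than merely
-- isometric. The diagonal consists of the norms of the unnormalised Gram–Schmidt vectors.
open InnerProductSpace in
theorem exists_unitary_mul_upperTriangular (g : GLH H) : ∃ k ∈ groupK H, ∃ r : BasisIndex κ → ℝ,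
    (∀ j, 0 < r j) ∧
      UpperTriangular ξ (fun j => (r j : ℂ)) ((k⁻¹ * g : GLH H) : H →L[ℂ] H) := by
  classical
  let f : BasisIndex κ → H := fun j => (g : H →L[ℂ] H) (ξ j)
  let γ : H ≃L[ℂ] H := ContinuousLinearEquiv.unitsEquiv ℂ H g
  have hγ : ∀ x, γ x = (g : H →L[ℂ] H) x := fun x => rfl
  have hf : LinearIndependent ℂ f :=
    ξ.orthonormal.linearIndependent.map' (γ : H →ₗ[ℂ] H)
      (LinearMap.ker_eq_bot.2 γ.injective)
  let e : BasisIndex κ → H := gramSchmidtNormed ℂ f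
  have he : Orthonormal ℂ e := gramSchmidtNormed_orthonormal hf
  have hspan : ⊤ ≤ (Submodule.span ℂ (Set.range e)).topologicalClosure := by
    rw [span_gramSchmidtNormed_range, span_gramSchmidt]
    have h1 : Set.range f = γ '' Set.range ξ := by
      rw [← Set.range_comp]
      rfl
    have h2 : Dense (Submodule.span ℂ (Set.range f) : Set H) := by
      have h3 : (Submodule.span ℂ (Set.range f) : Set H) =
          γ '' (Submodule.span ℂ (Set.range ξ) : Set H) := by
        rw [h1]
        have := Submodule.map_span (γ : H →ₗ[ℂ] H) (Set.range ξ)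
        exact (congrArg (fun S : Submodule ℂ H => (S : Set H)) this).symm
      rw [h3]
      refine DenseRange.dense_image γ.surjective.denseRange γ.continuous ?_
      rw [Submodule.dense_iff_topologicalClosure_eq_top]
      exact ξ.dense_span
    rw [Submodule.dense_iff_topologicalClosure_eq_top] at h2
    exact h2.ge
  let b := HilbertBasis.mk he hspan
  have hb : ∀ j, b j = e j := fun j => by rw [HilbertBasis.coe_mk]
  let U : H ≃ₗᵢ[ℂ] H := ξ.repr.trans b.repr.symm
  have hU : ∀ j, U (ξ j) = e j := by
    intro j
    rw [← hb]
    change b.repr.symm (ξ.repr (ξ j)) = b j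
    rw [ξ.repr_self, b.repr_symm_single]
  let k : GLH H := (ContinuousLinearEquiv.unitsEquiv ℂ H).symm U.toContinuousLinearEquiv
  have hk : ∀ x, (k : H →L[ℂ] H) x = U x := fun x => rfl
  have hk' : ∀ x, ((k⁻¹ : GLH H) : H →L[ℂ] H) x = U.symm x := fun x => rfl
  refine ⟨k, ?_, fun j => ‖gramSchmidt ℂ f j‖,
    fun j => norm_pos_iff.2 (gramSchmidt_ne_zero j hf), ?_⟩
  · change star (k : H →L[ℂ] H) * k = 1
    ext x
    refine ext_inner_left ℂ fun y => ?_
    rw [mul_apply_eq_comp, ContinuousLinearMap.star_eq_adjoint,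
      ContinuousLinearMap.adjoint_inner_right, hk, hk, U.inner_map_map, one_apply_eq_self]
  · intro j
    have hmem : f j - gramSchmidt ℂ f j ∈ Submodule.span ℂ (e '' Set.Iio j) := by
      rw [span_gramSchmidtNormed]
      nth_rw 1 [gramSchmidt_def' ℂ f j]
      rw [add_sub_cancel_left]
      refine Submodule.sum_mem _ fun i hi => ?_
      rw [Submodule.starProjection_singleton]
      exact Submodule.smul_mem _ _ (Submodule.subset_span ⟨i, Finset.mem_Iio.1 hi, rfl⟩)
    have hpre : Submodule.span ℂ (e '' Set.Iio j) ≤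
        (lowerSpan ξ j).comap (U.symm.toContinuousLinearEquiv : H →ₗ[ℂ] H) := by
      refine Submodule.span_le.2 ?_
      rintro _ ⟨l, hl, rfl⟩
      have : U.symm (e l) = ξ l := by rw [← hU, U.symm_apply_apply]
      change U.symm (e l) ∈ lowerSpan ξ j
      rw [this]
      exact basis_mem_lowerSpan ξ hl
    have h1 : U.symm (f j - gramSchmidt ℂ f j) ∈ lowerSpan ξ j := hpre hmem
    have h2 : gramSchmidt ℂ f j = (‖gramSchmidt ℂ f j‖ : ℂ) • e j := by
      have h0 : (‖gramSchmidt ℂ f j‖ : ℂ) ≠ 0 := by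
        exact_mod_cast norm_ne_zero_iff.2 (gramSchmidt_ne_zero j hf)
      exact (smul_inv_smul₀ h0 _).symm
    have h3 : U.symm (gramSchmidt ℂ f j) = (‖gramSchmidt ℂ f j‖ : ℂ) • ξ j :=
      (congrArg U.symm h2).trans (by rw [map_smul, ← hU j, U.symm_apply_apply])
    rw [map_sub, h3] at h1
    exact h1

/-- The diagonal part of the triangular factor is bounded with bounded inverse, because the
diagonals of `b` and `b⁻¹` are inverse to each other and each is dominated by an operator norm. -/
theorem iwasawaMul_surjective : Function.Surjective (iwasawaMul ξ) := by
  intro g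
  obtain ⟨k, hk, r, hr, hb⟩ := exists_unitary_mul_upperTriangular ξ g
  set b : GLH H := k⁻¹ * g with hbdef
  obtain ⟨S, hS⟩ := exists_diagonal ξ hb.norm_diag_le
  obtain ⟨S', hS'⟩ := exists_diagonal ξ hb.inv.norm_diag_le
  let a : GLH H :=
    { val := S
      inv := S'
      val_inv := HilbertBasis.ext_clm ξ fun j => by
        rw [mul_apply_eq_comp, hS', map_smul, hS, smul_smul, inv_mul_cancel₀ (hb.diag_ne_zero j)]
        simp
      inv_val := HilbertBasis.ext_clm ξ fun j => by
        rw [mul_apply_eq_comp, hS, map_smul, hS', smul_smul, mul_inv_cancel₀ (hb.diag_ne_zero j)]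
        simp }
  have ha : a ∈ groupA ξ := fun j => ⟨r j, hr j, hS j⟩
  obtain ⟨r', hr', har', hau'⟩ := exists_upperTriangular_of_mem_groupA ha
  have hau : UpperTriangular ξ (fun j => (r j : ℂ)) (a : H →L[ℂ] H) := fun j => by
    change S (ξ j) - _ ∈ _
    rw [hS, sub_self]
    exact zero_mem _
  have hn : (a⁻¹ * b : GLH H) ∈ groupN ξ := by
    intro j
    have h1 := (hau.inv.mul hb) j
    simp only [] at h1
    rw [inv_mul_cancel₀ (hb.diag_ne_zero j), one_smul] at h1
    exact h1
  refine ⟨(⟨k, hk⟩, ⟨a, ha⟩, ⟨a⁻¹ * b, hn⟩), ?_⟩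
  change k * a * (a⁻¹ * b) = g
  rw [hbdef]
  group

end Iwasawa

/-! ### The translation chart and the Cayley chart -/

section Charts

variable (B : Type*) [NormedRing B] [NormedAlgebra ℝ B] [CompleteSpace B]

/-- The chart `u ↦ u - 1` of the unit group, on the unit ball around `1`. -/
noncomputable def translationChart : OpenPartialHomeomorph Bˣ B :=
  ((Units.isOpenEmbedding_val.toOpenPartialHomeomorph (Units.val : Bˣ → B)).trans
    (Homeomorph.addRight (-1 : B)).toOpenPartialHomeomorph).restrOpen
    {u : Bˣ | ‖(u : B) - 1‖ < 1}
    (isOpen_lt (by fun_prop) continuous_const)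

variable {B}

theorem translationChart_apply (u : Bˣ) : translationChart B u = u - 1 := by
  simp [translationChart, sub_eq_add_neg]

theorem mem_translationChart_source {u : Bˣ} :
    u ∈ (translationChart B).source ↔ ‖(u : B) - 1‖ < 1 := by
  simp [translationChart]

theorem translationChart_symm_apply {X : B} (hX : X ∈ (translationChart B).target) :
    ((translationChart B).symm X : B) = 1 + X := by
  have h := (translationChart B).right_inv hX
  rw [translationChart_apply, sub_eq_iff_eq_add'] at h
  exact h

/-- The translation chart flattens a subgroup `S` onto `𝔰` if `u ∈ S ↔ u - 1 ∈ 𝔰`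
for units near `1`. -/
noncomputable def FlatteningChart.translation {S : Subgroup Bˣ} {𝔰 : Submodule ℝ B}
    (h : ∀ u : Bˣ, ‖(u : B) - 1‖ < 1 → (u ∈ S ↔ (u : B) - 1 ∈ 𝔰)) : FlatteningChart S 𝔰 where
  chart := translationChart B
  extension b := b - 1
  one_mem := by simp [mem_translationChart_source]
  map_one := by simp [translationChart_apply]
  extension_eq u _ := translationChart_apply u
  contDiffAt_extension u _ := contDiffAt_id.sub contDiffAt_const
  contDiffAt_symm X hX := by
    have h1 : ContDiffAt ℝ ∞ (fun X : B => 1 + X) X := contDiffAt_const.add contDiffAt_id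
    refine h1.congr_of_eventuallyEq ?_
    filter_upwards [(translationChart B).open_target.mem_nhds hX] with Y hY
    exact translationChart_symm_apply hY
  hasFDerivAt_symm := by
    have h1 : HasFDerivAt (fun X : B => 1 + X) (ContinuousLinearMap.id ℝ B) 0 :=
      (hasFDerivAt_id (𝕜 := ℝ) (0 : B)).const_add 1
    refine h1.congr_of_eventuallyEq ?_
    have h0 : (0 : B) ∈ (translationChart B).target := by
      have := (translationChart B).map_source (x := 1) (by simp [mem_translationChart_source])
      rwa [translationChart_apply, Units.val_one, sub_self] at this
    filter_upwards [(translationChart B).open_target.mem_nhds h0] with Y hY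
    exact translationChart_symm_apply hY
  mem_iff u hu := by
    rw [translationChart_apply]
    exact h u (mem_translationChart_source.1 hu)

theorem isUnit_ofNat_of_real (n : ℕ) [n.AtLeastTwo] : IsUnit (OfNat.ofNat n : B) := by
  have h : IsUnit (OfNat.ofNat n : ℝ) := isUnit_iff_ne_zero.2 (OfNat.ofNat_ne_zero n)
  have := h.map (algebraMap ℝ B)
  rwa [map_ofNat] at this

open Ring

theorem cayley_mul {u : B} (hu : IsUnit (u + 1)) :
    (2 * (u - 1) * inverse (u + 1)) * (u + 1) = 2 * (u - 1) := by
  rw [mul_assoc, Ring.inverse_mul_cancel _ hu, mul_one]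

theorem cayleyInv_mul {X : B} (hX : IsUnit (2 - X)) :
    ((2 + X) * inverse (2 - X)) * (2 - X) = 2 + X := by
  rw [mul_assoc, Ring.inverse_mul_cancel _ hX, mul_one]

theorem contDiffAt_cayley {u : B} (hu : IsUnit (u + 1)) :
    ContDiffAt ℝ ∞ (fun b : B => 2 * (b - 1) * inverse (b + 1)) u := by
  refine ContDiffAt.mul (contDiffAt_const.mul (contDiffAt_id.sub contDiffAt_const)) ?_
  obtain ⟨v, hv⟩ := hu
  have h1 : ContDiffAt ℝ ∞ (inverse : B → B) (u + 1) := by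
    rw [← hv]
    exact contDiffAt_ringInverse ℝ v
  exact ContDiffAt.comp (f := fun b : B => b + 1) u h1 (contDiffAt_id.add contDiffAt_const)

theorem contDiffAt_cayleyInv {X : B} (hX : IsUnit (2 - X)) :
    ContDiffAt ℝ ∞ (fun b : B => (2 + b) * inverse (2 - b)) X := by
  refine ContDiffAt.mul (contDiffAt_const.add contDiffAt_id) ?_
  obtain ⟨v, hv⟩ := hX
  have h1 : ContDiffAt ℝ ∞ (inverse : B → B) (2 - X) := by
    rw [← hv]
    exact contDiffAt_ringInverse ℝ v
  exact ContDiffAt.comp (f := fun b : B => 2 - b) X h1 (contDiffAt_const.sub contDiffAt_id)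

/-- Everything follows from `(2 - X)(u + 1) = 4` and `(2 + X)(u + 1) = 4 u`. The second identity
shows why the chart target also asks for `2 + X` to be invertible: this reflects the invertibility
of `u`. -/
theorem cayley_units {u : Bˣ} (hu : IsUnit ((u : B) + 1)) {X : B}
    (hX : X * (u + 1) = 2 * (u - 1)) :
    IsUnit (2 - X) ∧ IsUnit (2 + X) ∧ (u : B) * (2 - X) = 2 + X := by
  have h1 : (2 - X) * (u + 1) = 4 := by
    have h0 : (u : B) + 1 - (u - 1) = 1 + 1 := by abel
    rw [sub_mul, hX, ← mul_sub, h0]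
    norm_num
  have h2 : (2 + X) * (u + 1) = 4 * u := by
    rw [add_mul, hX]
    noncomm_ring
  obtain ⟨v, hv⟩ := hu
  rw [← hv] at h1 h2
  refine ⟨?_, ?_, ?_⟩
  · rw [← Units.isUnit_mul_units _ v, h1]
    exact isUnit_ofNat_of_real 4
  · rw [← Units.isUnit_mul_units _ v, h2]
    exact (isUnit_ofNat_of_real 4).mul u.isUnit
  · rw [← Units.mul_left_inj v, mul_assoc, h1, h2]
    noncomm_ring

theorem cayleyInv_units {u X : B} (hX : IsUnit (2 - X)) (hu : u * (2 - X) = 2 + X) :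
    IsUnit (u + 1) ∧ X * (u + 1) = 2 * (u - 1) := by
  have h1 : (u + 1) * (2 - X) = 4 := by
    rw [add_mul, hu, one_mul, add_add_sub_cancel]
    norm_num
  have h2 : (u - 1) * (2 - X) = 2 * X := by
    rw [sub_mul, hu, one_mul, two_mul]
    abel
  obtain ⟨w, hw⟩ := hX
  rw [← hw] at h1 h2
  refine ⟨?_, ?_⟩
  · rw [← Units.isUnit_mul_units _ w, h1]
    exact isUnit_ofNat_of_real 4
  · rw [← Units.mul_left_inj w, mul_assoc, mul_assoc, h1, h2]
    noncomm_ring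

open Classical in
variable (B) in
/-- The Cayley transform `u ↦ 2 (u - 1) (u + 1)⁻¹` as a chart of the unit group. -/
noncomputable def cayleyChart : OpenPartialHomeomorph Bˣ B where
  toFun u := 2 * ((u : B) - 1) * inverse ((u : B) + 1)
  invFun X := if h : IsUnit (2 - X) ∧ IsUnit (2 + X) then h.2.unit * h.1.unit⁻¹ else 1
  source := {u | IsUnit ((u : B) + 1)}
  target := {X | IsUnit (2 - X) ∧ IsUnit (2 + X)}
  map_source' u hu := by
    have h := cayley_units hu (cayley_mul hu)
    exact ⟨h.1, h.2.1⟩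
  map_target' X hX := by
    have hX' : IsUnit (2 - X) ∧ IsUnit (2 + X) := hX
    simp only [dif_pos hX']
    refine (cayleyInv_units hX'.1 ?_).1
    rw [Units.val_mul, mul_assoc]
    simp
  left_inv' u hu := by
    have h := cayley_units hu (cayley_mul hu)
    simp only [dif_pos (And.intro h.1 h.2.1)]
    apply Units.ext
    refine h.1.mul_left_inj.1 (Eq.trans ?_ h.2.2.symm)
    rw [Units.val_mul, mul_assoc]
    simp
  right_inv' X hX := by
    have hX' : IsUnit (2 - X) ∧ IsUnit (2 + X) := hX
    simp only [dif_pos hX']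
    have h := cayleyInv_units (u := ((hX'.2.unit * hX'.1.unit⁻¹ : Bˣ) : B)) hX'.1 (by
      rw [Units.val_mul, mul_assoc]
      simp)
    rw [← h.1.mul_left_inj, cayley_mul h.1, h.2]
  open_source := Units.isOpen.preimage (f := fun u : Bˣ => (u : B) + 1) (by fun_prop)
  open_target :=
    (Units.isOpen.preimage (f := fun X : B => 2 - X) (by fun_prop)).inter
      (Units.isOpen.preimage (f := fun X : B => 2 + X) (by fun_prop))
  continuousOn_toFun u hu :=
    ((contDiffAt_cayley hu).continuousAt.comp
      Units.continuous_val.continuousAt).continuousWithinAt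
  continuousOn_invFun := by
    rw [Units.isOpenEmbedding_val.isEmbedding.continuousOn_iff]
    have h1 : ContinuousOn (fun b : B => (2 + b) * inverse (2 - b))
        {X | IsUnit (2 - X) ∧ IsUnit (2 + X)} := fun X hX =>
      (contDiffAt_cayleyInv hX.1).continuousAt.continuousWithinAt
    refine h1.congr fun X hX => ?_
    have hX' : IsUnit (2 - X) ∧ IsUnit (2 + X) := hX
    simp only [Function.comp_apply, dif_pos hX']
    rw [← hX'.1.mul_left_inj, cayleyInv_mul hX'.1, Units.val_mul, mul_assoc]
    simp

theorem mem_cayleyChart_source {u : Bˣ} :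
    u ∈ (cayleyChart B).source ↔ IsUnit ((u : B) + 1) := Iff.rfl

theorem cayleyChart_apply (u : Bˣ) :
    cayleyChart B u = 2 * ((u : B) - 1) * inverse ((u : B) + 1) := rfl

theorem cayleyChart_symm_apply {X : B} (hX : X ∈ (cayleyChart B).target) :
    ((cayleyChart B).symm X : B) = (2 + X) * inverse (2 - X) := by
  have h1 := (cayleyChart B).map_target hX
  have h2 := cayley_mul h1
  rw [← cayleyChart_apply, (cayleyChart B).right_inv hX] at h2
  have h3 := (cayley_units h1 h2)
  rw [← h3.1.mul_left_inj, cayleyInv_mul h3.1, h3.2.2]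

theorem one_mem_cayleyChart_source : 1 ∈ (cayleyChart B).source := by
  rw [mem_cayleyChart_source, Units.val_one, one_add_one_eq_two]
  exact isUnit_ofNat_of_real 2

theorem cayleyChart_one : cayleyChart B 1 = 0 := by
  simp [cayleyChart_apply]

/-- Differentiate `G b * (2 - b) = 2 + b` at `0`, where `G 0 = 1`. The factor `2` in the Cayley
transform is there to make this derivative the identity. -/
theorem hasFDerivAt_cayleyInv :
    HasFDerivAt (fun b : B => (2 + b) * inverse (2 - b)) (ContinuousLinearMap.id ℝ B) 0 := by
  have hu : IsUnit (2 - 0 : B) := by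
    rw [sub_zero]
    exact isUnit_ofNat_of_real 2
  set G : B → B := fun b => (2 + b) * inverse (2 - b) with hG
  have hd : HasFDerivAt G (fderiv ℝ G 0) 0 :=
    ((contDiffAt_cayleyInv hu).differentiableAt (by simp)).hasFDerivAt
  have h1 := hd.mul' ((hasFDerivAt_id (𝕜 := ℝ) (0 : B)).const_sub 2)
  have h2 : HasFDerivAt (fun b : B => 2 + b) (ContinuousLinearMap.id ℝ B) 0 :=
    (hasFDerivAt_id (𝕜 := ℝ) (0 : B)).const_add 2
  have h3 : (fun b : B => 2 + b) =ᶠ[𝓝 0] (fun b => G b * (2 - b)) := by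
    have : ∀ᶠ b in 𝓝 (0 : B), IsUnit (2 - b) :=
      (Units.isOpen.preimage (f := fun X : B => 2 - X) (by fun_prop)).mem_nhds hu
    filter_upwards [this] with b hb
    exact (cayleyInv_mul hb).symm
  have h4 := (h1.congr_of_eventuallyEq h3).unique h2
  have hG0 : G 0 = 1 := by
    refine hu.mul_left_inj.1 ((cayleyInv_mul hu).trans ?_)
    rw [add_zero, sub_zero, one_mul]
  have h5 : fderiv ℝ G 0 = ContinuousLinearMap.id ℝ B := by
    ext Y
    have h6 := congrArg (fun L : B →L[ℝ] B => L Y) h4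
    simp [hG0] at h6
    have h7 : fderiv ℝ G 0 Y * 2 = Y * 2 := by
      rw [neg_add_eq_iff_eq_add] at h6
      rw [h6, mul_two]
    exact (isUnit_ofNat_of_real (B := B) 2).mul_left_inj.1 h7
  rwa [h5] at hd

/-- The Cayley transform flattens a subgroup `S` onto `𝔰` if it maps `S` to `𝔰` and conversely. -/
noncomputable def FlatteningChart.cayley {S : Subgroup Bˣ} {𝔰 : Submodule ℝ B}
    (h : ∀ u : Bˣ, IsUnit ((u : B) + 1) →
      (u ∈ S ↔ 2 * ((u : B) - 1) * inverse ((u : B) + 1) ∈ 𝔰)) : FlatteningChart S 𝔰 where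
  chart := cayleyChart B
  extension b := 2 * (b - 1) * inverse (b + 1)
  one_mem := one_mem_cayleyChart_source
  map_one := cayleyChart_one
  extension_eq u _ := cayleyChart_apply u
  contDiffAt_extension u hu := contDiffAt_cayley hu
  contDiffAt_symm X hX := by
    refine (contDiffAt_cayleyInv hX.1).congr_of_eventuallyEq ?_
    filter_upwards [(cayleyChart B).open_target.mem_nhds hX] with Y hY
    exact cayleyChart_symm_apply hY
  hasFDerivAt_symm := by
    refine hasFDerivAt_cayleyInv.congr_of_eventuallyEq ?_
    have h0 : (0 : B) ∈ (cayleyChart B).target := by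
      have := (cayleyChart B).map_source one_mem_cayleyChart_source
      rwa [cayleyChart_one] at this
    filter_upwards [(cayleyChart B).open_target.mem_nhds h0] with Y hY
    exact cayleyChart_symm_apply hY
  mem_iff u hu := h u hu

/-- After clearing denominators, `star X = -X` reads `(u* - 1)(u + 1) + (u* + 1)(u - 1) = 0`, whose
left side is `2 (u* u - 1)`. -/
theorem star_mul_self_eq_one_iff_cayley [StarRing B] {u X : B} (hu : IsUnit (u + 1))
    (huu : IsUnit u) (hX : X * (u + 1) = 2 * (u - 1)) : star u * u = 1 ↔ star X = -X := by
  have hstar : (star u + 1) * star X = (star u - 1) * 2 := by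
    have := congrArg star hX
    simpa [star_mul, star_ofNat] using this
  have hcomm : (u + 1) * X = 2 * (u - 1) := by
    rw [← hu.mul_left_inj, mul_assoc, hX]
    noncomm_ring
  constructor
  · intro h
    have h1 : (u + 1) * star X = (u + 1) * (-X) := by
      have h2 : star u * ((u + 1) * star X) = star u * ((u + 1) * (-X)) := by
        rw [mul_neg, hcomm]
        calc star u * ((u + 1) * star X) = (star u * u + star u) * star X := by noncomm_ring
          _ = (star u + 1) * star X := by rw [h, add_comm]
          _ = (star u - star u * u) * 2 := by rw [hstar, h]
          _ = star u * -(2 * (u - 1)) := by noncomm_ring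
      exact (huu.star.mul_right_inj).1 h2
    exact (hu.mul_right_inj).1 h1
  · intro h
    rw [h] at hstar
    have h1 : (star u + 1) * -X * (u + 1) = (star u - 1) * 2 * (u + 1) := by rw [hstar]
    rw [mul_assoc, neg_mul, hX] at h1
    have h2 : 4 * (star u * u) = 4 * 1 := by
      rw [← sub_eq_zero] at h1 ⊢
      rw [← neg_eq_zero, ← h1]
      noncomm_ring
    exact (isUnit_ofNat_of_real (B := B) 4).mul_right_inj.1 h2

end Charts

/-! ### Lie group structures on K, A and N -/

section Iwasawa

variable {H : Type*} [NormedAddCommGroup H] [InnerProductSpace ℂ H] [CompleteSpace H] {κ : ℕ∞}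
  (ξ : HilbertBasis (BasisIndex κ) ℂ H)

theorem isClosed_algK : IsClosed (algK H : Set (H →L[ℂ] H)) :=
  isClosed_eq continuous_star continuous_neg

theorem isClosed_algA : IsClosed (algA ξ : Set (H →L[ℂ] H)) := by
  have h : (algA ξ : Set (H →L[ℂ] H)) =
      ⋂ j, (fun Y : H →L[ℂ] H => Y (ξ j)) ⁻¹' (Submodule.span ℝ {ξ j} : Set H) := by
    ext Y
    simp only [Set.mem_iInter, Set.mem_preimage, SetLike.mem_coe, Submodule.mem_span_singleton]
    refine forall_congr' fun j => exists_congr fun r => ?_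
    rw [Complex.coe_smul, eq_comm]
  rw [h]
  refine isClosed_iInter fun j => IsClosed.preimage (by fun_prop) ?_
  exact Submodule.closed_of_finiteDimensional _

theorem isClosed_algN : IsClosed (algN ξ : Set (H →L[ℂ] H)) := by
  have h : (algN ξ : Set (H →L[ℂ] H)) =
      ⋂ j, (fun Y : H →L[ℂ] H => Y (ξ j)) ⁻¹' (lowerSpan ξ j : Set H) := by
    ext Y
    simp only [Set.mem_iInter, Set.mem_preimage, SetLike.mem_coe]
    rfl
  rw [h]
  refine isClosed_iInter fun j => IsClosed.preimage (by fun_prop) ?_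
  have := finiteDimensional_lowerSpan ξ j
  exact Submodule.closed_of_finiteDimensional _

variable (H) in
theorem exists_isLieGroupWithLieAlgebra_groupK :
    ∃ _cK : ChartedSpace (algK H).toSubmodule (groupK H),
        IsLieGroupWithLieAlgebra (groupK H) (algK H) := by
  let D : FlatteningChart (groupK H) (algK H).toSubmodule := FlatteningChart.cayley fun u hu =>
    star_mul_self_eq_one_iff_cayley hu u.isUnit (cayley_mul hu)
  exact ⟨D.chartedSpace, D.isLieGroupWithLieAlgebra isClosed_algK⟩

theorem exists_isLieGroupWithLieAlgebra_groupN :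
    ∃ _cN : ChartedSpace (algN ξ).toSubmodule (groupN ξ),
        IsLieGroupWithLieAlgebra (groupN ξ) (algN ξ) := by
  let D : FlatteningChart (groupN ξ) (algN ξ).toSubmodule :=
    FlatteningChart.translation fun u _ => Iff.rfl
  exact ⟨D.chartedSpace, D.isLieGroupWithLieAlgebra (isClosed_algN ξ)⟩

theorem exists_isLieGroupWithLieAlgebra_groupA :
    ∃ _cA : ChartedSpace (algA ξ).toSubmodule (groupA ξ),
        IsLieGroupWithLieAlgebra (groupA ξ) (algA ξ) := by
  let D : FlatteningChart (groupA ξ) (algA ξ).toSubmodule :=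
    FlatteningChart.translation fun u hu => by
      constructor
      · intro h j
        obtain ⟨r, -, hr⟩ := h j
        refine ⟨r - 1, ?_⟩
        rw [sub_apply, hr]
        simp [sub_smul]
      · intro h j
        obtain ⟨r, hr⟩ := h j
        refine ⟨1 + r, ?_, ?_⟩
        -- The chart radius `1` is what gives positivity: the eigenvalue `r` of `u - 1` satisfies
        -- `|r| < 1`, so `1 + r > 0`.
        · have h1 : ‖((u : H →L[ℂ] H) - 1) (ξ j)‖ ≤ ‖(u : H →L[ℂ] H) - 1‖ * ‖ξ j‖ :=
            ContinuousLinearMap.le_opNorm _ _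
          rw [hr, norm_smul, ξ.orthonormal.1 j, mul_one, mul_one, Complex.norm_real,
            Real.norm_eq_abs] at h1
          linarith [(abs_lt.1 (lt_of_le_of_lt h1 hu)).1]
        · rw [sub_apply, one_apply_eq_self, sub_eq_iff_eq_add] at hr
          rw [hr, Complex.ofReal_add, Complex.ofReal_one, add_smul, one_smul, add_comm]
  exact ⟨D.chartedSpace, D.isLieGroupWithLieAlgebra (isClosed_algA ξ)⟩

end Iwasawa

/-! ### Smooth bijections with invertible derivative -/

section InverseFunction

variable {E : Type*} [NormedAddCommGroup E] [NormedSpace ℝ E] [CompleteSpace E]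
  {H : Type*} [TopologicalSpace H] {I : ModelWithCorners ℝ E H} [I.Boundaryless]
  {M : Type*} [TopologicalSpace M] [ChartedSpace H M] [IsManifold I ∞ M]
  {E' : Type*} [NormedAddCommGroup E'] [NormedSpace ℝ E']
  {H' : Type*} [TopologicalSpace H'] {I' : ModelWithCorners ℝ E' H'} [I'.Boundaryless]
  {M' : Type*} [TopologicalSpace M'] [ChartedSpace H' M'] [IsManifold I' ∞ M']

/-- A left inverse of a smooth map is smooth at the image of every point where the derivative
is invertible. -/
theorem ContMDiff.contMDiffAt_leftInverse {f : M → M'} {g : M' → M}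
    (hf : ContMDiff I I' ∞ f) (hgf : Function.LeftInverse g f) {x : M}
    (e : E ≃L[ℝ] E') (he : ∀ v : TangentSpace I x, (mfderiv I I' f x v : E') = e v) :
    ContMDiffAt I' I ∞ g (f x) := by
  set φ := extChartAt I x with hφ
  set ψ := extChartAt I' (f x) with hψ
  set F : E → E' := writtenInExtChartAt I I' x f with hF
  have hFeq : ∀ z, F z = ψ (f (φ.symm z)) := fun z => rfl
  have hsm : ContDiffAt ℝ ∞ F (φ x) := by
    have := (contMDiffAt_iff.1 (hf x)).2
    rwa [I.range_eq_univ, contDiffWithinAt_univ] at this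
  have hder : HasFDerivAt F (e : E →L[ℝ] E') (φ x) := by
    have h2 : (mfderiv I I' f x : E →L[ℝ] E') = (e : E →L[ℝ] E') :=
      ContinuousLinearMap.ext he
    have h0 : ∀ L : E →L[ℝ] E', (mfderiv I I' f x : E →L[ℝ] E') = L →
        HasFDerivWithinAt F L (Set.range I) (φ x) := by
      rintro _ rfl
      exact ((hf.mdifferentiable (by simp)) x).hasMFDerivAt.2
    have h1 := h0 _ h2
    rwa [I.range_eq_univ, hasFDerivWithinAt_univ] at h1
  set G : E' → E := hsm.localInverse hder (by simp) with hG
  have hGsm : ContDiffAt ℝ ∞ G (F (φ x)) := hsm.to_localInverse hder (by simp)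
  have hFx : F (φ x) = ψ (f x) := by rw [hFeq, extChartAt_to_inv]
  have hFG : ∀ᶠ z in 𝓝 (ψ (f x)), F (G z) = z := by
    rw [← hFx]
    exact (hsm.hasStrictFDerivAt' hder (by simp)).eventually_right_inverse
  have hGx : G (ψ (f x)) = φ x := by
    rw [← hFx]
    exact (hsm.hasStrictFDerivAt' hder (by simp)).localInverse_apply_image
  rw [hFx] at hGsm
  have hψsm : ContMDiffAt I' 𝓘(ℝ, E') ∞ ψ (f x) := contMDiffAt_extChartAt
  have hφsm : ContMDiffAt 𝓘(ℝ, E) I ∞ φ.symm (φ x) :=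
    (contMDiffOn_extChartAt_symm x).contMDiffAt (extChartAt_target_mem_nhds x)
  have hh : ContMDiffAt I' I ∞ (fun y => φ.symm (G (ψ y))) (f x) := by
    have h1 : ContMDiffAt I' 𝓘(ℝ, E) ∞ (fun y => G (ψ y)) (f x) :=
      hGsm.contMDiffAt.comp (f x) hψsm
    rw [← hGx] at hφsm
    exact hφsm.comp (f x) h1
  have hhx : φ.symm (G (ψ (f x))) = x := by rw [hGx, extChartAt_to_inv]
  refine hh.congr_of_eventuallyEq ?_
  have hc1 : ∀ᶠ y in 𝓝 (f x), F (G (ψ y)) = ψ y := hψsm.continuousAt.eventually hFG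
  have hc2 : ∀ᶠ y in 𝓝 (f x), y ∈ ψ.source := extChartAt_source_mem_nhds (f x)
  have hc3 : ∀ᶠ y in 𝓝 (f x), f (φ.symm (G (ψ y))) ∈ ψ.source := by
    have hcont : ContinuousAt (fun y => f (φ.symm (G (ψ y)))) (f x) := by
      refine ContinuousAt.comp (g := f) ?_ hh.continuousAt
      exact hf.continuous.continuousAt
    refine hcont.eventually_mem ?_
    rw [hhx]
    exact extChartAt_source_mem_nhds (f x)
  filter_upwards [hc1, hc2, hc3] with y h1 h2 h3
  -- The local inverse gives a smooth right inverse of `f` near `f x`; applying the left inverse `g`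
  -- shows that it coincides with `g`, so no continuity of `g` is needed beforehand.
  have h4 : f (φ.symm (G (ψ y))) = y := ψ.injOn h3 h2 h1
  nth_rw 1 [← h4]
  exact hgf _

/-- A smooth bijection with invertible derivatives is a diffeomorphism. -/
theorem ContMDiff.exists_diffeomorph_of_bijective {f : M → M'} (hf : ContMDiff I I' ∞ f)
    (hb : Function.Bijective f)
    (he : ∀ x : M, ∃ e : E ≃L[ℝ] E', ∀ v : TangentSpace I x, (mfderiv I I' f x v : E') = e v) :
    ∃ Φ : Diffeomorph I I' M M' ∞, (Φ : M → M') = f := by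
  let e := Equiv.ofBijective f hb
  refine ⟨⟨e, hf, fun y => ?_⟩, rfl⟩
  obtain ⟨x, rfl⟩ := hb.2 y
  obtain ⟨L, hL⟩ := he x
  exact hf.contMDiffAt_leftInverse e.left_inv L hL

end InverseFunction

/-! ### The direct sum condition on the Lie algebras -/

theorem DirectSum.isInternal_three_iff {R M : Type*} [Ring R] [AddCommGroup M] [Module R M]
    (A B C : Submodule R M) : DirectSum.IsInternal ![A, B, C] ↔
      (∀ a ∈ A, ∀ b ∈ B, ∀ c ∈ C, a + b + c = 0 → a = 0 ∧ b = 0 ∧ c = 0) ∧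
        ∀ x, ∃ a ∈ A, ∃ b ∈ B, ∃ c ∈ C, a + b + c = x := by
  rw [DirectSum.isInternal_submodule_iff_iSupIndep_and_iSup_eq_top]
  refine and_congr ?_ ?_
  · constructor
    · intro h a ha b hb c hc habc
      have hle : ∀ i j : Fin 3, j ≠ i → ∀ x ∈ (![A, B, C] j : Submodule R M),
          x ∈ ⨆ (k) (_ : k ≠ i), (![A, B, C] k : Submodule R M) :=
        fun i j hij x hx => le_iSup₂_of_le (f := fun k (_ : k ≠ i) => (![A, B, C] k)) j hij le_rfl hx
      refine ⟨?_, ?_, ?_⟩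
      · refine Submodule.disjoint_def.1 (h 0) a ha ?_
        have : a = -(b + c) := eq_neg_of_add_eq_zero_left (by rw [← add_assoc, habc])
        rw [this]
        exact neg_mem (add_mem (hle 0 1 (by decide) b hb) (hle 0 2 (by decide) c hc))
      · refine Submodule.disjoint_def.1 (h 1) b hb ?_
        have : b = -(a + c) := eq_neg_of_add_eq_zero_left (by rw [← habc]; abel)
        rw [this]
        exact neg_mem (add_mem (hle 1 0 (by decide) a ha) (hle 1 2 (by decide) c hc))
      · refine Submodule.disjoint_def.1 (h 2) c hc ?_
        have : c = -(a + b) := eq_neg_of_add_eq_zero_left (by rw [← habc]; abel)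
        rw [this]
        exact neg_mem (add_mem (hle 2 0 (by decide) a ha) (hle 2 1 (by decide) b hb))
    · intro h i
      rw [iSup_fin_three, Submodule.disjoint_def]
      intro x hx hx'
      fin_cases i
      · simp only [Fin.zero_eta, Fin.isValue, Matrix.cons_val_zero, ne_eq, not_true_eq_false,
          iSup_false, one_ne_zero, not_false_eq_true, iSup_pos, bot_sup_eq, Fin.reduceEq,
          Matrix.cons_val_one, Matrix.cons_val] at hx hx'
        obtain ⟨b, hb, c, hc, rfl⟩ := Submodule.mem_sup.1 hx'
        have := h (b + c) hx (-b) (neg_mem hb) (-c) (neg_mem hc) (by abel)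
        exact this.1
      · simp only [Fin.mk_one, Fin.isValue, Matrix.cons_val_one, ne_eq, zero_ne_one,
          not_false_eq_true, iSup_pos, not_true_eq_false, iSup_false, sup_bot_eq, Fin.reduceEq,
          Matrix.cons_val_zero, Matrix.cons_val] at hx hx'
        obtain ⟨b, hb, c, hc, rfl⟩ := Submodule.mem_sup.1 hx'
        have := h (-b) (neg_mem hb) (b + c) hx (-c) (neg_mem hc) (by abel)
        exact this.2.1
      · simp only [Fin.reduceFinMk, Fin.isValue, Matrix.cons_val, ne_eq, Fin.reduceEq,
          not_false_eq_true, iSup_pos, not_true_eq_false, iSup_false, sup_bot_eq,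
          Matrix.cons_val_zero, Matrix.cons_val_one] at hx hx'
        obtain ⟨b, hb, c, hc, rfl⟩ := Submodule.mem_sup.1 hx'
        have := h (-b) (neg_mem hb) (-c) (neg_mem hc) (b + c) hx (by abel)
        exact this.2.2
  · rw [iSup_fin_three, Submodule.eq_top_iff']
    refine forall_congr' fun x => ?_
    simp only [Fin.isValue, Matrix.cons_val_zero, Matrix.cons_val_one, Matrix.cons_val,
      Submodule.mem_sup]
    constructor
    · rintro ⟨y, ⟨a, ha, b, hb, rfl⟩, c, hc, rfl⟩
      exact ⟨a, ha, b, hb, c, hc, rfl⟩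
    · rintro ⟨a, ha, b, hb, c, hc, rfl⟩
      exact ⟨a + b, ⟨a, ha, b, hb, rfl⟩, c, hc, rfl⟩

section Iwasawa

variable {H : Type*} [NormedAddCommGroup H] [InnerProductSpace ℂ H] {κ : ℕ∞}
  {ξ : HilbertBasis (BasisIndex κ) ℂ H}

theorem exists_upperTriangular_of_mem_algA {Y : H →L[ℂ] H} (hY : Y ∈ algA ξ) :
    ∃ r : BasisIndex κ → ℝ, (∀ j, Y (ξ j) = (r j : ℂ) • ξ j) ∧
      UpperTriangular ξ (fun j => (r j : ℂ)) Y := by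
  choose r h using hY
  exact ⟨r, h, fun j => by rw [h, sub_self]; exact zero_mem _⟩

theorem mem_algN_iff_upperTriangular {Z : H →L[ℂ] H} :
    Z ∈ algN ξ ↔ UpperTriangular ξ (fun _ => 0) Z := by
  refine forall_congr' fun j => ?_
  rw [zero_smul, sub_zero]

/-- Here `-X = Y + Z` is skew-adjoint and upper triangular with real diagonal, hence zero; the
diagonal of `Y + Z = 0` then kills `Y`. Thus only the spanning condition carries information. -/
theorem iwasawa_independent [CompleteSpace H] {X Y Z : H →L[ℂ] H} (hX : X ∈ algK H)
    (hY : Y ∈ algA ξ) (hZ : Z ∈ algN ξ) (h : X + Y + Z = 0) : X = 0 ∧ Y = 0 ∧ Z = 0 := by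
  obtain ⟨r, hr, hYr⟩ := exists_upperTriangular_of_mem_algA hY
  rw [mem_algN_iff_upperTriangular] at hZ
  have hX' : star X = -X := hX
  have h1 : UpperTriangular ξ (fun j => (r j : ℂ)) (-X) := by
    have h2 := hYr.add hZ
    simp only [add_zero] at h2
    rw [add_assoc, add_eq_zero_iff_neg_eq] at h
    rwa [h]
  have hX0 : X = 0 := by
    rw [← neg_eq_zero]
    exact h1.eq_zero_of_skew (by rw [star_neg, hX'])
  rw [hX0, zero_add] at h
  have hr0 : ∀ j, (r j : ℂ) = 0 := by
    intro j
    have h2 := (hYr.add hZ).inner_self j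
    rw [h] at h2
    simpa using h2.symm
  have hY0 : Y = 0 := HilbertBasis.ext_clm ξ fun j => by rw [hr, hr0]; simp
  rw [hY0, zero_add] at h
  exact ⟨hX0, hY0, h⟩

variable [CompleteSpace H]

theorem isIwasawaDirectSum_iff :
    IsIwasawaDirectSum ξ ↔ ∀ T : H →L[ℂ] H, ∃ X ∈ algK H, ∃ Y ∈ algA ξ, ∃ Z ∈ algN ξ,
      X + Y + Z = T := by
  refine (DirectSum.isInternal_three_iff _ _ _).trans ?_
  exact and_iff_right fun X hX Y hY Z hZ h => iwasawa_independent hX hY hZ h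

end Iwasawa

/-! ### The derivative of the multiplication map -/

section LieGroup

variable {E : Type*} [NormedAddCommGroup E] [NormedSpace ℝ E]
  {G : Type*} [TopologicalSpace G] [ChartedSpace E G] [Group G] [LieGroup 𝓘(ℝ, E) ∞ G]

theorem exists_mulInvariantVectorField_eq (g : G) (X : TangentSpace 𝓘(ℝ, E) g) :
    ∃ X₀ : GroupLieAlgebra 𝓘(ℝ, E) G, mulInvariantVectorField X₀ g = X := by
  have hd : ∀ h : G, MDifferentiable 𝓘(ℝ, E) 𝓘(ℝ, E) (h * · : G → G) := fun h =>
    (contMDiff_mul_left (I := 𝓘(ℝ, E)) (n := ∞)).mdifferentiable (by simp)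
  have h1 : ∀ y, y = 1 → HasMFDerivAt 𝓘(ℝ, E) 𝓘(ℝ, E) (g * · : G → G) y
      (mfderiv 𝓘(ℝ, E) 𝓘(ℝ, E) (g * · : G → G) 1 : E →L[ℝ] E) := by
    rintro _ rfl
    exact (hd g 1).hasMFDerivAt
  have h2 := (h1 (g⁻¹ * g) (inv_mul_cancel g)).comp g (hd g⁻¹ g).hasMFDerivAt
  have h3 : (g * · : G → G) ∘ (g⁻¹ * ·) = id := by
    ext
    simp
  rw [h3] at h2
  have h4 := hasMFDerivAt_unique h2 (hasMFDerivAt_id g)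
  exact ⟨mfderiv 𝓘(ℝ, E) 𝓘(ℝ, E) (g⁻¹ * · : G → G) g X, congrArg (fun L => L X) h4⟩

end LieGroup

section Product

variable {B : Type*} [NormedRing B] [NormedAlgebra ℝ B]
  {E₁ E₂ E₃ : Type*} [NormedAddCommGroup E₁] [NormedSpace ℝ E₁]
  [NormedAddCommGroup E₂] [NormedSpace ℝ E₂] [NormedAddCommGroup E₃] [NormedSpace ℝ E₃]
  {M₁ M₂ M₃ : Type*} [TopologicalSpace M₁] [ChartedSpace E₁ M₁] [TopologicalSpace M₂]
  [ChartedSpace E₂ M₂] [TopologicalSpace M₃] [ChartedSpace E₃ M₃]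

theorem mfderiv_mul_mul {f₁ : M₁ → B} {f₂ : M₂ → B} {f₃ : M₃ → B}
    (h₁ : MDifferentiable 𝓘(ℝ, E₁) 𝓘(ℝ, B) f₁) (h₂ : MDifferentiable 𝓘(ℝ, E₂) 𝓘(ℝ, B) f₂)
    (h₃ : MDifferentiable 𝓘(ℝ, E₃) 𝓘(ℝ, B) f₃) (p : M₁ × M₂ × M₃) (v : E₁ × E₂ × E₃) :
    (mfderiv (𝓘(ℝ, E₁).prod (𝓘(ℝ, E₂).prod 𝓘(ℝ, E₃))) 𝓘(ℝ, B)
      (fun q : M₁ × M₂ × M₃ => f₁ q.1 * f₂ q.2.1 * f₃ q.2.2) p :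
        E₁ × E₂ × E₃ →L[ℝ] B) v =
      (derivInto f₁ p.1 : E₁ →L[ℝ] B) v.1 * f₂ p.2.1 * f₃ p.2.2 +
      f₁ p.1 * (derivInto f₂ p.2.1 : E₂ →L[ℝ] B) v.2.1 * f₃ p.2.2 +
      f₁ p.1 * f₂ p.2.1 * (derivInto f₃ p.2.2 : E₃ →L[ℝ] B) v.2.2 := by
  have k₁ := (h₁ p.1).hasMFDerivAt.comp p
    (hasMFDerivAt_fst (I := 𝓘(ℝ, E₁)) (I' := 𝓘(ℝ, E₂).prod 𝓘(ℝ, E₃)) p)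
  have k₂ := (h₂ p.2.1).hasMFDerivAt.comp p
    ((hasMFDerivAt_fst (I := 𝓘(ℝ, E₂)) (I' := 𝓘(ℝ, E₃)) p.2).comp p
    (hasMFDerivAt_snd (I := 𝓘(ℝ, E₁)) (I' := 𝓘(ℝ, E₂).prod 𝓘(ℝ, E₃)) p))
  have k₃ := (h₃ p.2.2).hasMFDerivAt.comp p
    ((hasMFDerivAt_snd (I := 𝓘(ℝ, E₂)) (I' := 𝓘(ℝ, E₃)) p.2).comp p
    (hasMFDerivAt_snd (I := 𝓘(ℝ, E₁)) (I' := 𝓘(ℝ, E₂).prod 𝓘(ℝ, E₃)) p))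
  have k := ((k₁.mul' k₂).mul' k₃).mfderiv
  refine (congrArg (fun L : E₁ × E₂ × E₃ →L[ℝ] B => L v) k).trans ?_
  change f₁ p.1 * f₂ p.2.1 * (derivInto f₃ p.2.2 : E₃ →L[ℝ] B) v.2.2 +
    (f₁ p.1 * (derivInto f₂ p.2.1 : E₂ →L[ℝ] B) v.2.1 +
      (derivInto f₁ p.1 : E₁ →L[ℝ] B) v.1 * f₂ p.2.1) * f₃ p.2.2 = _
  rw [add_mul]
  abel

end Product

theorem mfderiv_units_eq_mfderiv_val {E : Type*} [NormedAddCommGroup E] [NormedSpace ℝ E]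
    {H : Type*} [TopologicalSpace H] {I : ModelWithCorners ℝ E H}
    {M : Type*} [TopologicalSpace M] [ChartedSpace H M]
    {B : Type*} [NormedRing B] [NormedAlgebra ℝ B] [CompleteSpace B]
    {f : M → Bˣ} (hf : ContMDiff I 𝓘(ℝ, B) ∞ f) (x : M) :
    (mfderiv I 𝓘(ℝ, B) f x : E →L[ℝ] B) = mfderiv I 𝓘(ℝ, B) (fun y => (f y : B)) x := by
  have h1 : MDifferentiableAt I 𝓘(ℝ, B) f x := hf.mdifferentiable (by simp) x
  have h2 : MDifferentiableAt I 𝓘(ℝ, B) (fun y => (f y : B)) x :=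
    (Units.contMDiff_val.comp hf).mdifferentiable (by simp) x
  exact h1.mfderiv.trans h2.mfderiv.symm

section Subgroup

variable {H : Type*} [NormedAddCommGroup H] [InnerProductSpace ℂ H] [CompleteSpace H]

namespace IsLieGroupWithLieAlgebra

variable {S : Subgroup (GLH H)} {𝔰 : LieSubalgebra ℝ (H →L[ℂ] H)}
    [ChartedSpace 𝔰.toSubmodule S]

theorem contMDiff_val (h : IsLieGroupWithLieAlgebra S 𝔰) :
    ContMDiff 𝓘(ℝ, 𝔰.toSubmodule) 𝓘(ℝ, H →L[ℂ] H) ∞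
      (fun g : S => ((g : GLH H) : H →L[ℂ] H)) :=
  Units.contMDiff_val.comp h.contMDiff_incl

/-- The derivative of the inclusion at `g` maps the tangent space isomorphically to `g 𝔰`. -/
theorem exists_linearEquiv (h : IsLieGroupWithLieAlgebra S 𝔰) (g : S) :
    ∃ e : 𝔰.toSubmodule ≃ₗ[ℝ] 𝔰.toSubmodule, ∀ X : 𝔰.toSubmodule,
    (derivInto (fun g : S => ((g : GLH H) : H →L[ℂ] H)) g :
      𝔰.toSubmodule →L[ℝ] (H →L[ℂ] H)) X = ((g : GLH H) : H →L[ℂ] H) * (e X : H →L[ℂ] H) := by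
  have := h.lieGroup
  obtain ⟨e, he, -⟩ := h.lieAlgebra
  have hι : ContMDiff 𝓘(ℝ, 𝔰.toSubmodule) 𝓘(ℝ, H →L[ℂ] H) ∞
      ((Units.coeHom (H →L[ℂ] H)).comp S.subtype) := h.contMDiff_val
  have he' : ∀ X : GroupLieAlgebra 𝓘(ℝ, 𝔰.toSubmodule) S,
      derivInto ((Units.coeHom (H →L[ℂ] H)).comp S.subtype) 1 X = (e X : H →L[ℂ] H) := fun X =>
    (congrArg (fun L => L X) (mfderiv_units_eq_derivInto h.contMDiff_incl 1)).symm.trans (he X)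
  have hmul : ∀ X : GroupLieAlgebra 𝓘(ℝ, 𝔰.toSubmodule) S,
      derivInto ((Units.coeHom (H →L[ℂ] H)).comp S.subtype) g (mulInvariantVectorField X g) =
        ((g : GLH H) : H →L[ℂ] H) * (e X : H →L[ℂ] H) := fun X => by
    rw [derivInto_mul_left hι, he']
    rfl
  let D₀ : 𝔰.toSubmodule →L[ℝ] 𝔰.toSubmodule :=
    mfderiv 𝓘(ℝ, 𝔰.toSubmodule) 𝓘(ℝ, 𝔰.toSubmodule) (g * · : S → S) 1
  let D : 𝔰.toSubmodule →ₗ[ℝ] 𝔰.toSubmodule := D₀.toLinearMap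
  have hDsurj : Function.Surjective D := fun X => exists_mulInvariantVectorField_eq g X
  -- Injectivity is seen in `B(H)`: the derivative of the inclusion turns translation into `g * e
  -- X`, and `g` is invertible.
  have hDinj : Function.Injective D := by
    rw [injective_iff_map_eq_zero]
    intro X hX
    have h1 := hmul X
    have h2 : (mulInvariantVectorField (I := 𝓘(ℝ, 𝔰.toSubmodule))
      (X : GroupLieAlgebra 𝓘(ℝ, 𝔰.toSubmodule) S) g) = 0 := hX
    rw [h2, map_zero] at h1
    have h3 : (e X : H →L[ℂ] H) = 0 := by
      have := congrArg (fun T => (((g : GLH H)⁻¹ : GLH H) : H →L[ℂ] H) * T) h1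
      simpa [← mul_assoc] using this.symm
    have h4 : e X = 0 := Subtype.ext h3
    exact (map_eq_zero_iff e e.injective).1 h4
  let D' := LinearEquiv.ofBijective D ⟨hDinj, hDsurj⟩
  let e' : 𝔰.toSubmodule ≃ₗ[ℝ] 𝔰.toSubmodule := e.toLinearEquiv
  refine ⟨D'.symm.trans e', fun X => ?_⟩
  obtain ⟨X₀, rfl⟩ := D'.surjective X
  have h5 : (D'.symm.trans e') (D' X₀) = e' X₀ := by simp
  rw [h5]
  exact hmul X₀

end IsLieGroupWithLieAlgebra

end Subgroup

section Product

variable {B : Type*} [NormedRing B] [NormedAlgebra ℝ B] [CompleteSpace B]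
  {E₁ E₂ E₃ : Type*} [NormedAddCommGroup E₁] [NormedSpace ℝ E₁]
  [NormedAddCommGroup E₂] [NormedSpace ℝ E₂] [NormedAddCommGroup E₃] [NormedSpace ℝ E₃]
  {M₁ M₂ M₃ : Type*} [TopologicalSpace M₁] [ChartedSpace E₁ M₁] [TopologicalSpace M₂]
  [ChartedSpace E₂ M₂] [TopologicalSpace M₃] [ChartedSpace E₃ M₃]

theorem mfderiv_units_mul_mul {f : M₁ × M₂ × M₃ → Bˣ}
    (hf : ContMDiff (𝓘(ℝ, E₁).prod (𝓘(ℝ, E₂).prod 𝓘(ℝ, E₃))) 𝓘(ℝ, B) ∞ f)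
    {f₁ : M₁ → B} {f₂ : M₂ → B} {f₃ : M₃ → B}
    (hff : ∀ q, (f q : B) = f₁ q.1 * f₂ q.2.1 * f₃ q.2.2)
    (h₁ : MDifferentiable 𝓘(ℝ, E₁) 𝓘(ℝ, B) f₁) (h₂ : MDifferentiable 𝓘(ℝ, E₂) 𝓘(ℝ, B) f₂)
    (h₃ : MDifferentiable 𝓘(ℝ, E₃) 𝓘(ℝ, B) f₃) (p : M₁ × M₂ × M₃) (v : E₁ × E₂ × E₃) :
    (mfderiv (𝓘(ℝ, E₁).prod (𝓘(ℝ, E₂).prod 𝓘(ℝ, E₃))) 𝓘(ℝ, B) f p :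
        E₁ × E₂ × E₃ →L[ℝ] B) v =
      (derivInto f₁ p.1 : E₁ →L[ℝ] B) v.1 * f₂ p.2.1 * f₃ p.2.2 +
      f₁ p.1 * (derivInto f₂ p.2.1 : E₂ →L[ℝ] B) v.2.1 * f₃ p.2.2 +
      f₁ p.1 * f₂ p.2.1 * (derivInto f₃ p.2.2 : E₃ →L[ℝ] B) v.2.2 := by
  have k : (fun q => (f q : B)) = fun q : M₁ × M₂ × M₃ => f₁ q.1 * f₂ q.2.1 * f₃ q.2.2 :=
    funext hff
  have k' := mfderiv_units_eq_mfderiv_val hf p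
  have k₁ := mfderiv_mul_mul h₁ h₂ h₃ p v
  rw [← k] at k₁
  exact (congrArg (fun L : E₁ × E₂ × E₃ →L[ℝ] B => L v) k').trans k₁

end Product

section Iwasawa

variable {H : Type*} [NormedAddCommGroup H] [InnerProductSpace ℂ H] {κ : ℕ∞}
  {ξ : HilbertBasis (BasisIndex κ) ℂ H}

theorem conj_mem_algN {r : BasisIndex κ → ℂ} {u : (H →L[ℂ] H)ˣ}
    (hu : UpperTriangular ξ r (u : H →L[ℂ] H)) {Z : H →L[ℂ] H} (hZ : Z ∈ algN ξ) :
    (u : H →L[ℂ] H) * Z * ((u⁻¹ : (H →L[ℂ] H)ˣ) : H →L[ℂ] H) ∈ algN ξ := by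
  rw [mem_algN_iff_upperTriangular] at hZ ⊢
  simpa using (hu.mul hZ).mul hu.inv

variable [CompleteSpace H]

theorem commute_of_mem_groupA_of_mem_algA {a : GLH H} (ha : a ∈ groupA ξ) {Y : H →L[ℂ] H}
    (hY : Y ∈ algA ξ) : (a : H →L[ℂ] H) * Y = Y * a := by
  obtain ⟨r, -, har, -⟩ := exists_upperTriangular_of_mem_groupA ha
  obtain ⟨s, hs, -⟩ := exists_upperTriangular_of_mem_algA hY
  refine HilbertBasis.ext_clm ξ fun j => ?_
  simp only [mul_apply_eq_comp, har, hs, map_smul, smul_smul, mul_comm]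

/-- The derivative of `(k, a, n) ↦ k a n` in the left trivialisations of the three groups. -/
def iwasawaDeriv (p : groupK H × groupA ξ × groupN ξ) (X Y Z : H →L[ℂ] H) : H →L[ℂ] H :=
  ((p.1 : GLH H) : H →L[ℂ] H) * X * ((p.2.1 : GLH H) : H →L[ℂ] H) *
    ((p.2.2 : GLH H) : H →L[ℂ] H) +
  ((p.1 : GLH H) : H →L[ℂ] H) * (((p.2.1 : GLH H) : H →L[ℂ] H) * Y) *
    ((p.2.2 : GLH H) : H →L[ℂ] H) +
  ((p.1 : GLH H) : H →L[ℂ] H) * ((p.2.1 : GLH H) : H →L[ℂ] H) *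
    (((p.2.2 : GLH H) : H →L[ℂ] H) * Z)

/-- With `u = a n`, pull `k` out on the left and `u` on the right. Since `a` commutes with `𝔞`, the
`Y` term needs no conjugation and only `Z` is conjugated by `u`. -/
theorem iwasawaDeriv_eq (p : groupK H × groupA ξ × groupN ξ) {X Y Z : H →L[ℂ] H}
    (hY : Y ∈ algA ξ) : iwasawaDeriv p X Y Z =
      ((p.1 : GLH H) : H →L[ℂ] H) * (X + Y + (((p.2.1 : GLH H) * (p.2.2 : GLH H) : GLH H) :
        H →L[ℂ] H) * Z * ((((p.2.1 : GLH H) * (p.2.2 : GLH H))⁻¹ : GLH H) : H →L[ℂ] H)) *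
      (((p.2.1 : GLH H) * (p.2.2 : GLH H) : GLH H) : H →L[ℂ] H) := by
  rw [iwasawaDeriv, commute_of_mem_groupA_of_mem_algA p.2.1.2 hY]
  simp only [mul_add, add_mul, mul_assoc, Units.inv_mul, mul_one]
  simp only [Units.val_mul, mul_assoc]

theorem upperTriangular_mul_of_mem {a n : GLH H} (ha : a ∈ groupA ξ) (hn : n ∈ groupN ξ) :
    ∃ r : BasisIndex κ → ℂ, UpperTriangular ξ r ((a * n : GLH H) : H →L[ℂ] H) := by
  obtain ⟨r, -, -, hau⟩ := exists_upperTriangular_of_mem_groupA ha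
  exact ⟨_, hau.mul (upperTriangular_of_mem_groupN hn)⟩

theorem iwasawaDeriv_eq_zero (p : groupK H × groupA ξ × groupN ξ) {X Y Z : H →L[ℂ] H}
    (hX : X ∈ algK H) (hY : Y ∈ algA ξ) (hZ : Z ∈ algN ξ) (h : iwasawaDeriv p X Y Z = 0) :
    X = 0 ∧ Y = 0 ∧ Z = 0 := by
  obtain ⟨r, hr⟩ := upperTriangular_mul_of_mem p.2.1.2 p.2.2.2
  rw [iwasawaDeriv_eq p hY, Units.mul_left_eq_zero, Units.mul_right_eq_zero] at h
  obtain ⟨h1, h2, h3⟩ := iwasawa_independent hX hY (conj_mem_algN hr hZ) h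
  rw [Units.mul_left_eq_zero, Units.mul_right_eq_zero] at h3
  exact ⟨h1, h2, h3⟩

theorem exists_iwasawaDeriv_eq (hξ : IsIwasawaDirectSum ξ) (p : groupK H × groupA ξ × groupN ξ)
    (T : H →L[ℂ] H) :
    ∃ X ∈ algK H, ∃ Y ∈ algA ξ, ∃ Z ∈ algN ξ, iwasawaDeriv p X Y Z = T := by
  obtain ⟨r, hr⟩ := upperTriangular_mul_of_mem p.2.1.2 p.2.2.2
  set u : GLH H := (p.2.1 : GLH H) * (p.2.2 : GLH H) with hu
  -- Decompose `k⁻¹ T u⁻¹`, then conjugate its `𝔫` component back by `u⁻¹`.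
  obtain ⟨X, hX, Y, hY, Z, hZ, h⟩ := isIwasawaDirectSum_iff.1 hξ
    ((((p.1 : GLH H)⁻¹ : GLH H) : H →L[ℂ] H) * T * ((u⁻¹ : GLH H) : H →L[ℂ] H))
  have hZ' := conj_mem_algN hr.inv hZ
  refine ⟨X, hX, Y, hY, _, hZ', ?_⟩
  rw [iwasawaDeriv_eq p hY, ← hu]
  have h2 : ((u : H →L[ℂ] H) * (((u⁻¹ : GLH H) : H →L[ℂ] H) * Z *
      (((u⁻¹)⁻¹ : GLH H) : H →L[ℂ] H)) * ((u⁻¹ : GLH H) : H →L[ℂ] H)) = Z := by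
    simp [mul_assoc]
  rw [h2, h]
  simp [mul_assoc]

/-! ### Diffeomorphism versus direct sum -/

section Structures

variable [ChartedSpace (algK H).toSubmodule (groupK H)]
  [ChartedSpace (algA ξ).toSubmodule (groupA ξ)]
  [ChartedSpace (algN ξ).toSubmodule (groupN ξ)]

theorem contMDiff_iwasawaMul (hK : IsLieGroupWithLieAlgebra (groupK H) (algK H))
    (hA : IsLieGroupWithLieAlgebra (groupA ξ) (algA ξ))
    (hN : IsLieGroupWithLieAlgebra (groupN ξ) (algN ξ)) :
    ContMDiff (𝓘(ℝ, (algK H).toSubmodule).prod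
        (𝓘(ℝ, (algA ξ).toSubmodule).prod 𝓘(ℝ, (algN ξ).toSubmodule)))
      𝓘(ℝ, H →L[ℂ] H) ∞ (iwasawaMul ξ) :=
  ((hK.contMDiff_incl.comp contMDiff_fst).mul
    (hA.contMDiff_incl.comp (contMDiff_fst.comp contMDiff_snd))).mul
    (hN.contMDiff_incl.comp (contMDiff_snd.comp contMDiff_snd))

set_option maxHeartbeats 1000000 in
theorem exists_mfderiv_iwasawaMul_eq (hK : IsLieGroupWithLieAlgebra (groupK H) (algK H))
    (hA : IsLieGroupWithLieAlgebra (groupA ξ) (algA ξ))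
    (hN : IsLieGroupWithLieAlgebra (groupN ξ) (algN ξ)) (p : groupK H × groupA ξ × groupN ξ) :
    ∃ (e₁ : (algK H).toSubmodule ≃ₗ[ℝ] (algK H).toSubmodule)
      (e₂ : (algA ξ).toSubmodule ≃ₗ[ℝ] (algA ξ).toSubmodule)
      (e₃ : (algN ξ).toSubmodule ≃ₗ[ℝ] (algN ξ).toSubmodule),
    ∀ v : (algK H).toSubmodule × (algA ξ).toSubmodule × (algN ξ).toSubmodule,
    (mfderiv (𝓘(ℝ, (algK H).toSubmodule).prod
        (𝓘(ℝ, (algA ξ).toSubmodule).prod 𝓘(ℝ, (algN ξ).toSubmodule)))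
      𝓘(ℝ, H →L[ℂ] H) (iwasawaMul ξ) p :
      (algK H).toSubmodule × (algA ξ).toSubmodule × (algN ξ).toSubmodule →L[ℝ] H →L[ℂ] H) v =
      iwasawaDeriv p (e₁ v.1 : H →L[ℂ] H) (e₂ v.2.1 : H →L[ℂ] H) (e₃ v.2.2 : H →L[ℂ] H) := by
  obtain ⟨e₁, h₁⟩ := hK.exists_linearEquiv p.1
  obtain ⟨e₂, h₂⟩ := hA.exists_linearEquiv p.2.1
  obtain ⟨e₃, h₃⟩ := hN.exists_linearEquiv p.2.2
  refine ⟨e₁, e₂, e₃, fun v => ?_⟩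
  have k := mfderiv_units_mul_mul (contMDiff_iwasawaMul hK hA hN) (fun _ => rfl)
    (hK.contMDiff_val.mdifferentiable (by simp))
    (hA.contMDiff_val.mdifferentiable (by simp))
    (hN.contMDiff_val.mdifferentiable (by simp)) p v
  rw [h₁, h₂, h₃] at k
  exact k

theorem isIwasawaDirectSum_of_diffeomorph (hK : IsLieGroupWithLieAlgebra (groupK H) (algK H))
    (hA : IsLieGroupWithLieAlgebra (groupA ξ) (algA ξ))
    (hN : IsLieGroupWithLieAlgebra (groupN ξ) (algN ξ))
    (Φ : Diffeomorph (𝓘(ℝ, (algK H).toSubmodule).prod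
          (𝓘(ℝ, (algA ξ).toSubmodule).prod 𝓘(ℝ, (algN ξ).toSubmodule)))
        𝓘(ℝ, H →L[ℂ] H) (groupK H × groupA ξ × groupN ξ) (GLH H) ∞)
    (hΦ : (Φ : groupK H × groupA ξ × groupN ξ → GLH H) = iwasawaMul ξ) :
    IsIwasawaDirectSum ξ := by
  rw [isIwasawaDirectSum_iff]
  intro T
  -- At the identity the derivative is `X + Y + Z`, up to automorphisms of the three factors, so its
  -- surjectivity is the spanning condition.
  obtain ⟨e₁, e₂, e₃, he⟩ := exists_mfderiv_iwasawaMul_eq hK hA hN 1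
  have hs := (Φ.mfderivToContinuousLinearEquiv (by simp) 1).surjective T
  obtain ⟨v, hv⟩ := hs
  refine ⟨e₁ v.1, (e₁ v.1).2, e₂ v.2.1, (e₂ v.2.1).2, e₃ v.2.2, (e₃ v.2.2).2, ?_⟩
  rw [← hΦ] at he
  have h := (he v).symm.trans hv
  have h' : iwasawaDeriv 1 (e₁ v.1 : H →L[ℂ] H) (e₂ v.2.1 : H →L[ℂ] H)
    (e₃ v.2.2 : H →L[ℂ] H) = T := h
  simpa [iwasawaDeriv] using h'

theorem exists_diffeomorph_of_isIwasawaDirectSum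
    (hK : IsLieGroupWithLieAlgebra (groupK H) (algK H))
    (hA : IsLieGroupWithLieAlgebra (groupA ξ) (algA ξ))
    (hN : IsLieGroupWithLieAlgebra (groupN ξ) (algN ξ)) (hξ : IsIwasawaDirectSum ξ) :
    ∃ Φ : Diffeomorph (𝓘(ℝ, (algK H).toSubmodule).prod
          (𝓘(ℝ, (algA ξ).toSubmodule).prod 𝓘(ℝ, (algN ξ).toSubmodule)))
        𝓘(ℝ, H →L[ℂ] H) (groupK H × groupA ξ × groupN ξ) (GLH H) ∞,
      (Φ : groupK H × groupA ξ × groupN ξ → GLH H) = iwasawaMul ξ := by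
  have := hK.lieGroup
  have := hA.lieGroup
  have := hN.lieGroup
  have : IsManifold 𝓘(ℝ, (algK H).toSubmodule) ∞ (groupK H) := hK.lieGroup.toIsManifold
  have : IsManifold 𝓘(ℝ, (algA ξ).toSubmodule) ∞ (groupA ξ) := hA.lieGroup.toIsManifold
  have : IsManifold 𝓘(ℝ, (algN ξ).toSubmodule) ∞ (groupN ξ) := hN.lieGroup.toIsManifold
  have : CompleteSpace (algK H).toSubmodule := (isClosed_algK (H := H)).completeSpace_coe
  have : CompleteSpace (algA ξ).toSubmodule := (isClosed_algA ξ).completeSpace_coe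
  have : CompleteSpace (algN ξ).toSubmodule := (isClosed_algN ξ).completeSpace_coe
  refine (contMDiff_iwasawaMul hK hA hN).exists_diffeomorph_of_bijective
    ⟨iwasawaMul_injective ξ, iwasawaMul_surjective ξ⟩ fun p => ?_
  obtain ⟨e₁, e₂, e₃, he⟩ := exists_mfderiv_iwasawaMul_eq hK hA hN p
  let D : (algK H).toSubmodule × (algA ξ).toSubmodule × (algN ξ).toSubmodule →L[ℝ] H →L[ℂ] H :=
    mfderiv (𝓘(ℝ, (algK H).toSubmodule).prod
        (𝓘(ℝ, (algA ξ).toSubmodule).prod 𝓘(ℝ, (algN ξ).toSubmodule)))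
      𝓘(ℝ, H →L[ℂ] H) (iwasawaMul ξ) p
  have hinj : Function.Injective D := by
    rw [injective_iff_map_eq_zero]
    intro v hv
    obtain ⟨h1, h2, h3⟩ := iwasawaDeriv_eq_zero p (e₁ v.1).2 (e₂ v.2.1).2 (e₃ v.2.2).2
      ((he v).symm.trans hv)
    simp only [Submodule.coe_eq_zero, EmbeddingLike.map_eq_zero_iff] at h1 h2 h3
    exact Prod.ext h1 (Prod.ext h2 h3)
  have hsurj : Function.Surjective D := by
    intro T
    obtain ⟨X, hX, Y, hY, Z, hZ, h⟩ := exists_iwasawaDeriv_eq hξ p T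
    refine ⟨(e₁.symm ⟨X, hX⟩, e₂.symm ⟨Y, hY⟩, e₃.symm ⟨Z, hZ⟩), (he _).trans ?_⟩
    refine Eq.trans ?_ h
    simp only [LinearEquiv.apply_symm_apply]
    rfl
  exact ⟨ContinuousLinearEquiv.ofBijective D (LinearMap.ker_eq_bot.2 hinj)
    (LinearMap.range_eq_top.2 hsurj), fun v => rfl⟩

end Structures

end Iwasawa

/-! ### The Hilbert matrix and its unbounded triangular truncation -/

section Fourier

open MeasureTheory AddCircle

/-- Multiplication by a bounded function has a Toeplitz matrix in the Fourier basis. -/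
theorem exists_mulOperator_fourierLp {T : ℝ} [Fact (0 < T)] {f : AddCircle T → ℂ} {C : ℝ}
    (hf : AEStronglyMeasurable f haarAddCircle) (hC : ∀ x, ‖f x‖ ≤ C) :
    ∃ M : Lp ℂ 2 (haarAddCircle (T := T)) →L[ℂ] Lp ℂ 2 (haarAddCircle (T := T)),
      ∀ m n : ℤ, inner ℂ (fourierLp 2 m) (M (fourierLp 2 n)) = fourierCoeff f (m - n) := by
  have hmem : MemLp f ⊤ (haarAddCircle (T := T)) :=
    memLp_top_of_bound hf C (Eventually.of_forall hC)
  refine ⟨(ContinuousLinearMap.mul ℂ ℂ).holderL haarAddCircle ⊤ 2 2 hmem.toLp, fun m n => ?_⟩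
  rw [L2.inner_def, fourierCoeff]
  refine integral_congr_ae ?_
  have h := (ContinuousLinearMap.mul ℂ ℂ).coeFn_holder (r := 2)
    (hmem.toLp (μ := haarAddCircle)) (fourierLp 2 n)
  filter_upwards [coeFn_fourierLp 2 m, coeFn_fourierLp 2 n, hmem.coeFn_toLp, h] with x h1 h2 h3 h4
  rw [ContinuousLinearMap.holderL_apply_apply, h4, h1, h2, h3, neg_sub, sub_eq_add_neg,
    fourier_add, fourier_neg]
  simp only [RCLike.inner_apply, ContinuousLinearMap.mul_apply', smul_eq_mul]
  ring

/-- The symbol is the sawtooth `x - 1/2`. For `m = n` the right side is `0` by the convention for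
division by zero, matching the vanishing mean of the sawtooth. -/
theorem exists_mulOperator_bernoulli :
    ∃ M : Lp ℂ 2 (haarAddCircle (T := (1 : ℝ))) →L[ℂ] Lp ℂ 2 (haarAddCircle (T := (1 : ℝ))),
      ∀ m n : ℤ, inner ℂ (fourierLp 2 m) (M (fourierLp 2 n)) =
        -1 / (2 * Real.pi * Complex.I * (m - n : ℤ)) := by
  have hm : Measurable (periodizedBernoulli 1) := by
    have hp : Measurable (bernoulliFun 1) := (Polynomial.continuous _).measurable
    exact hp.comp (measurable_subtype_coe.comp (AddCircle.measurableEquivIco (1 : ℝ) 0).measurable)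
  have hb : ∀ x, ‖(periodizedBernoulli 1 x : ℂ)‖ ≤ 1 := by
    intro x
    have hx := (AddCircle.equivIco (1 : ℝ) 0 x).2
    have : periodizedBernoulli 1 x = (AddCircle.equivIco (1 : ℝ) 0 x : ℝ) - 1 / 2 :=
      bernoulliFun_one _
    rw [Complex.norm_real, this, Real.norm_eq_abs, abs_le]
    have h1 := hx.1
    have h2 := hx.2
    constructor <;> linarith
  obtain ⟨M, hM⟩ := exists_mulOperator_fourierLp
    (f := ((↑) ∘ periodizedBernoulli 1 : AddCircle (1 : ℝ) → ℂ))
    (Complex.measurable_ofReal.comp hm).aestronglyMeasurable hb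
  refine ⟨M, fun m n => ?_⟩
  rw [hM, fourierCoeff_bernoulli_eq one_ne_zero]
  simp

end Fourier

section Iwasawa

variable {H : Type*} [NormedAddCommGroup H] [InnerProductSpace ℂ H] [CompleteSpace H] {κ : ℕ∞}

/-- The Hilbert matrix with entries proportional to `1 / (i - j)` defines a bounded operator. -/
theorem exists_hilbertMatrix (ξ : HilbertBasis (BasisIndex κ) ℂ H) :
    ∃ T : H →L[ℂ] H, ∀ i j : BasisIndex κ, inner ℂ (ξ i) (T (ξ j)) =
      -1 / (2 * Real.pi * Complex.I * (((i : ℕ) : ℂ) - (j : ℕ))) := by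
  classical
  obtain ⟨M, hM⟩ := exists_mulOperator_bernoulli
  have hv : Orthonormal ℂ (fun j : BasisIndex κ => fourierLp (T := (1 : ℝ)) 2 ((j : ℕ) : ℤ)) :=
    orthonormal_fourier.comp (fun j : BasisIndex κ => ((j : ℕ) : ℤ))
      (Nat.cast_injective.comp Subtype.val_injective)
  -- `V` sends `ξ_j` to the exponential of frequency `j`, so `V* M V` is the corner of the Toeplitz
  -- matrix of `M` indexed by the frequencies `j` in the index set.
  let V := hv.orthogonalFamily.linearIsometry.comp ξ.repr.toLinearIsometry
  have hV : ∀ j, V (ξ j) = fourierLp (T := (1 : ℝ)) 2 ((j : ℕ) : ℤ) := by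
    intro j
    change hv.orthogonalFamily.linearIsometry (ξ.repr (ξ j)) = _
    rw [ξ.repr_self, OrthogonalFamily.linearIsometry_apply_single]
    simp
  refine ⟨V.toContinuousLinearMap.adjoint ∘L M ∘L V.toContinuousLinearMap, fun i j => ?_⟩
  simp only [ContinuousLinearMap.comp_apply, ContinuousLinearMap.adjoint_inner_right,
    LinearIsometry.coe_toContinuousLinearMap, hV, hM]
  push_cast
  rfl

end Iwasawa

theorem Orthonormal.norm_sq_sum_eq_card {ι E : Type*} [NormedAddCommGroup E]
    [InnerProductSpace ℂ E] {v : ι → E} (hv : Orthonormal ℂ v) (s : Finset ι) :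
    ‖∑ i ∈ s, v i‖ ^ 2 = s.card := by
  classical
  have h := hv.inner_sum (fun _ => 1) (fun _ => 1) s
  simp only [one_smul, map_one, mul_one, Finset.sum_const, nsmul_eq_mul] at h
  rw [norm_sq_eq_re_inner (𝕜 := ℂ), h]
  simp

/-- Each row `i < n` contains all of `1, 1/2, …, 1/n`, in the columns `i + 1 + m < 2n`; the other
entries are nonnegative. -/
theorem mul_sum_one_div_le_sum_sum (n : ℕ) :
    n * ∑ m ∈ Finset.range n, (1 / ((m : ℝ) + 1)) ≤
      ∑ i ∈ Finset.range n, ∑ j ∈ Finset.range (2 * n),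
        (if i < j then 1 / ((j : ℝ) - i) else 0) := by
  have h : ∀ i ∈ Finset.range n, ∑ m ∈ Finset.range n, (1 / ((m : ℝ) + 1)) ≤
      ∑ j ∈ Finset.range (2 * n), (if i < j then 1 / ((j : ℝ) - i) else 0) := by
    intro i hi
    rw [Finset.mem_range] at hi
    have h1 : ∑ m ∈ Finset.range n, (1 / ((m : ℝ) + 1)) =
        ∑ j ∈ (Finset.range n).image (fun m => i + 1 + m),
          (if i < j then 1 / ((j : ℝ) - i) else 0) := by
      rw [Finset.sum_image fun a _ b _ hab => Nat.add_left_cancel hab]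
      refine Finset.sum_congr rfl fun m _ => ?_
      rw [if_pos (by omega)]
      push_cast
      congr 1
      ring
    rw [h1]
    refine Finset.sum_le_sum_of_subset_of_nonneg ?_ fun j _ _ => ?_
    · intro j hj
      simp only [Finset.mem_image, Finset.mem_range] at hj ⊢
      omega
    · split_ifs with hij
      · have : (i : ℝ) < j := by exact_mod_cast hij
        exact one_div_nonneg.2 (by linarith)
      · rfl
  have h2 := Finset.card_nsmul_le_sum _ _ _ h
  simpa using h2

/-- The strictly upper triangular part of the Hilbert matrix is unbounded. -/
theorem Orthonormal.false_of_inner_eq {E : Type*} [NormedAddCommGroup E] [InnerProductSpace ℂ E]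
    {v : ℕ → E} (hv : Orthonormal ℂ v) (Z : E →L[ℂ] E) {c : ℂ} (hc : c ≠ 0)
    (hZ : ∀ i j, inner ℂ (v i) (Z (v j)) =
      c * ((if i < j then 1 / ((j : ℝ) - i) else 0 : ℝ) : ℂ)) : False := by
  have hbound : ∀ n : ℕ, 1 ≤ n →
      ∑ m ∈ Finset.range n, (1 / ((m : ℝ) + 1)) ≤ 2 * ‖Z‖ / ‖c‖ := by
    intro n hn
    have hc' : 0 < ‖c‖ := norm_pos_iff.2 hc
    have hn' : (0 : ℝ) < n := by exact_mod_cast hn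
    set R := ∑ i ∈ Finset.range n, ∑ j ∈ Finset.range (2 * n),
        (if i < j then 1 / ((j : ℝ) - i) else 0) with hR
    set x := ∑ j ∈ Finset.range (2 * n), v j with hx
    set y := ∑ i ∈ Finset.range n, v i with hy
    have hxn : ‖x‖ ^ 2 = 2 * n := by
      have := hv.norm_sq_sum_eq_card (Finset.range (2 * n))
      simpa using this
    have hyn : ‖y‖ ^ 2 = n := by
      have := hv.norm_sq_sum_eq_card (Finset.range n)
      simpa using this
    have h1 : inner ℂ y (Z x) = c * (R : ℂ) := by
      rw [hx, hy, map_sum, sum_inner, hR, Complex.ofReal_sum, Finset.mul_sum]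
      refine Finset.sum_congr rfl fun i _ => ?_
      rw [inner_sum, Complex.ofReal_sum, Finset.mul_sum]
      exact Finset.sum_congr rfl fun j _ => hZ i j
    have h2 := mul_sum_one_div_le_sum_sum n
    rw [← hR] at h2
    have h3 : ‖c‖ * R ≤ ‖y‖ * (‖Z‖ * ‖x‖) := by
      have h4 : ‖inner ℂ y (Z x)‖ ≤ ‖y‖ * (‖Z‖ * ‖x‖) :=
        (norm_inner_le_norm y (Z x)).trans (by gcongr; exact Z.le_opNorm x)
      rw [h1, norm_mul, Complex.norm_real] at h4
      exact (mul_le_mul_of_nonneg_left (le_abs_self R) hc'.le).trans h4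
    -- Here `‖x‖² = 2n` and `‖y‖² = n`, so `‖y‖ ‖x‖ ≤ 3n/2` already. Thus `⟨y, Z x⟩` grows at most
    -- linearly in `n`, against a lower bound of `‖c‖ n` times a harmonic sum.
    have h5 : ‖y‖ * ‖x‖ ≤ 2 * n := by
      nlinarith [sq_nonneg (‖x‖ - ‖y‖)]
    have h6 : ‖y‖ * (‖Z‖ * ‖x‖) ≤ ‖Z‖ * (2 * n) := by
      have := mul_le_mul_of_nonneg_left h5 (norm_nonneg Z)
      linarith
    rw [le_div_iff₀ hc']
    set S := ∑ m ∈ Finset.range n, (1 / ((m : ℝ) + 1))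
    have h7 : n * (S * ‖c‖) ≤ n * (2 * ‖Z‖) := by
      have := mul_le_mul_of_nonneg_left h2 hc'.le
      linarith
    exact le_of_mul_le_mul_left h7 hn'
  have ht := Real.tendsto_sum_range_one_div_nat_succ_atTop
  obtain ⟨n, hn1, hn2⟩ := ((ht.eventually_gt_atTop (2 * ‖Z‖ / ‖c‖)).and
    (eventually_ge_atTop 1)).exists
  exact absurd (hbound n hn2) (not_le.2 hn1)

/-! ### The direct sum holds exactly in finite dimension -/

section Iwasawa

variable {H : Type*} [NormedAddCommGroup H] [InnerProductSpace ℂ H] {κ : ℕ∞}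
  {ξ : HilbertBasis (BasisIndex κ) ℂ H}

theorem inner_eq_zero_of_mem_algN {Z : H →L[ℂ] H} (hZ : Z ∈ algN ξ) {i j : BasisIndex κ}
    (h : j ≤ i) : inner ℂ (ξ i) (Z (ξ j)) = 0 :=
  inner_eq_zero_of_mem_lowerSpan ξ h (hZ j)

variable [CompleteSpace H]

theorem mem_algK_iff {X : H →L[ℂ] H} : X ∈ algK H ↔
    ∀ i j, inner ℂ (ξ i) (X (ξ j)) = -(starRingEnd ℂ) (inner ℂ (ξ j) (X (ξ i))) := by
  have hstar : ∀ i j, inner ℂ (ξ i) ((star X) (ξ j)) =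
      (starRingEnd ℂ) (inner ℂ (ξ j) (X (ξ i))) := by
    intro i j
    rw [ContinuousLinearMap.star_eq_adjoint, ContinuousLinearMap.adjoint_inner_right,
      inner_conj_symm]
  constructor
  · intro hX i j
    have hX : star X = -X := hX
    rw [← hstar, hX, neg_apply, inner_neg_right, neg_neg]
  · intro h
    change star X = -X
    refine HilbertBasis.ext_clm ξ fun j => HilbertBasis.ext_inner ξ fun i => ?_
    rw [hstar, neg_apply, inner_neg_right, h, map_neg, Complex.conj_conj]

/-- Above the diagonal `Y` vanishes and the entry of `X` is minus the conjugate of the mirrored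
entry, where `T` and `X` agree. So the `𝔫` component is forced by `T`. -/
theorem inner_algN_part {X Y Z T : H →L[ℂ] H} (hX : X ∈ algK H) (hY : Y ∈ algA ξ)
    (hZ : Z ∈ algN ξ) (h : X + Y + Z = T) {i j : BasisIndex κ} (hij : i < j) :
    inner ℂ (ξ i) (Z (ξ j)) =
      inner ℂ (ξ i) (T (ξ j)) + (starRingEnd ℂ) (inner ℂ (ξ j) (T (ξ i))) := by
  obtain ⟨r, hr⟩ := exists_upperTriangular_of_mem_algA hY
  rw [← h]
  simp only [add_apply, inner_add_right, hr.1, inner_smul_right, inner_basis_eq_zero ξ hij.ne,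
    inner_basis_eq_zero ξ hij.ne', inner_eq_zero_of_mem_algN hZ hij.le, mul_zero, add_zero]
  rw [mem_algK_iff.1 hX i j]
  ring

theorem IsIwasawaDirectSum.finiteDimensional (hξ : IsIwasawaDirectSum ξ) :
    FiniteDimensional ℂ H := by
  by_cases hκ : κ = ⊤
  · exfalso
    subst hκ
    obtain ⟨T, hT⟩ := exists_hilbertMatrix ξ
    obtain ⟨X, hX, Y, hY, Z, hZ, h⟩ := isIwasawaDirectSum_iff.1 hξ T
    let b : ℕ → BasisIndex ⊤ := fun n => ⟨n, ENat.natCast_lt_top n⟩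
    have hb : Function.Injective b := fun m n hmn => congrArg Subtype.val hmn
    -- The Hilbert matrix is self-adjoint, so `Z` has entries `2 t i j = (1 / (π i)) · 1 / (j - i)`
    -- above the diagonal (with `i` in the first factor the imaginary unit).
    have hc : (1 / (Real.pi * Complex.I) : ℂ) ≠ 0 := by
      simp [Real.pi_ne_zero]
    refine (ξ.orthonormal.comp b hb).false_of_inner_eq Z hc fun i j => ?_
    split_ifs with hij
    · refine (inner_algN_part hX hY hZ h (i := b i) (j := b j) hij).trans ?_
      have hij' : (i : ℂ) - j ≠ 0 := sub_ne_zero.2 (by exact_mod_cast hij.ne)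
      have hji' : (j : ℂ) - i ≠ 0 := sub_ne_zero.2 (by exact_mod_cast hij.ne')
      rw [hT, hT]
      have hπ : (Real.pi : ℂ) ≠ 0 := by exact_mod_cast Real.pi_ne_zero
      simp only [b, map_div₀, map_neg, map_one, map_mul, map_sub, map_natCast, Complex.conj_I,
        Complex.conj_ofReal, map_ofNat]
      push_cast
      rw [← neg_sub (j : ℂ) i]
      field_simp
      norm_num
    · rw [Complex.ofReal_zero, mul_zero]
      exact inner_eq_zero_of_mem_algN hZ (i := b i) (j := b j) (not_lt.1 hij)
  · have : Finite (BasisIndex κ) := by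
      obtain ⟨n, rfl⟩ := ENat.ne_top_iff_exists.1 hκ
      exact Finite.of_injective (β := Fin n) (fun j => ⟨j, by exact_mod_cast j.2⟩)
        fun i j hij => Subtype.ext (congrArg Fin.val hij)
    have := Fintype.ofFinite (BasisIndex κ)
    exact ξ.toOrthonormalBasis.toBasis.finiteDimensional_of_finite

theorem isIwasawaDirectSum_of_finiteDimensional (hH : FiniteDimensional ℂ H) :
    IsIwasawaDirectSum ξ := by
  classical
  have : Finite (BasisIndex κ) := ξ.orthonormal.linearIndependent.finite
  have := Fintype.ofFinite (BasisIndex κ)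
  rw [isIwasawaDirectSum_iff]
  intro T
  let t : BasisIndex κ → BasisIndex κ → ℂ := fun i j => inner ℂ (ξ i) (T (ξ j))
  have ht : ∀ i j, inner ℂ (ξ i) (T (ξ j)) = t i j := fun i j => rfl
  let L : (BasisIndex κ → H) → H →L[ℂ] H := fun w =>
    LinearMap.toContinuousLinearMap (ξ.toOrthonormalBasis.toBasis.constr ℂ w)
  have hL : ∀ w j, L w (ξ j) = w j := by
    intro w j
    have h := ξ.toOrthonormalBasis.toBasis.constr_basis ℂ w j
    simpa [L] using h
  -- The forced choice: `Y` is the real part of the diagonal, `Z` doubles up the mirrored entries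
  -- above it, and what remains of `T` is skew-adjoint.
  let Y := L fun j => ((t j j).re : ℂ) • ξ j
  let Z := L fun j => ∑ i, (if i < j then t i j + (starRingEnd ℂ) (t j i) else 0) • ξ i
  have hY : ∀ j, Y (ξ j) = ((t j j).re : ℂ) • ξ j := hL _
  have hZ : ∀ j, Z (ξ j) =
    ∑ i, (if i < j then t i j + (starRingEnd ℂ) (t j i) else 0) • ξ i := hL _
  refine ⟨T - Y - Z, (mem_algK_iff (ξ := ξ)).2 fun i j => ?_, Y, fun j => ⟨_, hY j⟩, Z,
    fun j => ?_, by abel⟩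
  · have hYi : ∀ i j, inner ℂ (ξ i) (Y (ξ j)) = if i = j then ((t j j).re : ℂ) else 0 := by
      intro i j
      rw [hY, inner_smul_right, orthonormal_iff_ite.1 ξ.orthonormal]
      simp
    have hZi : ∀ i j, inner ℂ (ξ i) (Z (ξ j)) =
        if i < j then t i j + (starRingEnd ℂ) (t j i) else 0 := by
      intro i j
      rw [hZ]
      exact ξ.orthonormal.inner_right_fintype _ i
    simp only [sub_apply, inner_sub_right, hYi, hZi, ht]
    rcases lt_trichotomy i j with h | rfl | h
    · simp [h, h.ne, h.ne', h.not_gt]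
    · simp only [lt_irrefl, if_true, if_false, sub_zero, map_sub, Complex.conj_ofReal]
      apply Complex.ext <;> simp
    · simp [h, h.ne, h.ne', h.not_gt]
  · rw [hZ]
    refine Submodule.sum_mem _ fun i _ => ?_
    split_ifs with h
    · exact Submodule.smul_mem _ _ (basis_mem_lowerSpan ξ h)
    · simp

end Iwasawa

end

theorem proposition1p1 {H : Type*} [NormedAddCommGroup H] [InnerProductSpace ℂ H]
    [CompleteSpace H] (κ : ℕ∞) (ξ : HilbertBasis (BasisIndex κ) ℂ H) :
    -- the three Lie subalgebras are closed
    (IsClosed (algK H : Set (H →L[ℂ] H)) ∧ IsClosed (algA ξ : Set (H →L[ℂ] H)) ∧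
      IsClosed (algN ξ : Set (H →L[ℂ] H))) ∧
    -- the subgroups are Banach-Lie groups with these Lie algebras
    ((∃ _cK : ChartedSpace (algK H).toSubmodule (groupK H),
        IsLieGroupWithLieAlgebra (groupK H) (algK H)) ∧
      (∃ _cA : ChartedSpace (algA ξ).toSubmodule (groupA ξ),
        IsLieGroupWithLieAlgebra (groupA ξ) (algA ξ)) ∧
      (∃ _cN : ChartedSpace (algN ξ).toSubmodule (groupN ξ),
        IsLieGroupWithLieAlgebra (groupN ξ) (algN ξ))) ∧
    -- multiplication is bijective
    Function.Bijective (iwasawaMul ξ) ∧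
    -- for any such Banach-Lie group structures, multiplication is smooth, and it is a
    -- diffeomorphism exactly when the direct sum decomposition holds
    (∀ (_cK : ChartedSpace (algK H).toSubmodule (groupK H))
       (_cA : ChartedSpace (algA ξ).toSubmodule (groupA ξ))
       (_cN : ChartedSpace (algN ξ).toSubmodule (groupN ξ)),
      IsLieGroupWithLieAlgebra (groupK H) (algK H) →
      IsLieGroupWithLieAlgebra (groupA ξ) (algA ξ) →
      IsLieGroupWithLieAlgebra (groupN ξ) (algN ξ) →
        ContMDiff
          (𝓘(ℝ, (algK H).toSubmodule).prod
            (𝓘(ℝ, (algA ξ).toSubmodule).prod 𝓘(ℝ, (algN ξ).toSubmodule)))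
          𝓘(ℝ, H →L[ℂ] H) ∞ (iwasawaMul ξ) ∧
        ((∃ Φ : Diffeomorph
            (𝓘(ℝ, (algK H).toSubmodule).prod
              (𝓘(ℝ, (algA ξ).toSubmodule).prod 𝓘(ℝ, (algN ξ).toSubmodule)))
            𝓘(ℝ, H →L[ℂ] H) (groupK H × groupA ξ × groupN ξ) (GLH H) ∞,
            (Φ : groupK H × groupA ξ × groupN ξ → GLH H) = iwasawaMul ξ) ↔
          IsIwasawaDirectSum ξ)) ∧
    -- the direct sum decomposition holds exactly in finite dimension
    (IsIwasawaDirectSum ξ ↔ FiniteDimensional ℂ H) := by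
  refine ⟨⟨isClosed_algK, isClosed_algA ξ, isClosed_algN ξ⟩,
    ⟨exists_isLieGroupWithLieAlgebra_groupK H, exists_isLieGroupWithLieAlgebra_groupA ξ,
      exists_isLieGroupWithLieAlgebra_groupN ξ⟩,
    ⟨iwasawaMul_injective ξ, iwasawaMul_surjective ξ⟩, fun _ _ _ hK hA hN =>
      ⟨contMDiff_iwasawaMul hK hA hN,
        fun ⟨Φ, hΦ⟩ => isIwasawaDirectSum_of_diffeomorph hK hA hN Φ hΦ,
        exists_diffeomorph_of_isIwasawaDirectSum hK hA hN⟩,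
    IsIwasawaDirectSum.finiteDimensional, isIwasawaDirectSum_of_finiteDimensional⟩
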